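/- For a set $V$, a weight function $w: V \to (0,\infty)$ and a quota $q>0$, the quota complex $X[w:q]$ is the abstract simplicial complex whose faces are the nonempty finite subsets $F \subseteq V$ with $\sum_{v\in F} w(v) < q$. Let $\mathrm{LogPrime}(q)$ be the quota complex with quota $q$ on the set of all primes, where the prime $p$ has weight $\ln p$. For a simplicial complex $K$ with finitely many faces let $\chi(K)=\sum_{j\ge 0}(-1)^j c_j$, where $c_j$ is the number of $j$-dimensional faces of $K$ (faces with $j+1$ vertices). Let $\mu$ be the Möbius function and $M(N)=\sum_{n=1}^N\mu(n)$ the Mertens function. **Theorem (Euler characteristic of the LogPrime complex).** 1. For every real $q>0$ the complex $\mathrm{LogPrime}(q)$ has finitely many faces, and $$\chi(\mathrm{LogPrime}(q)) = -\sum_{2\le n<e^q}\mu(n).$$ 2. For every integer $N\ge 1$, $$\chi(\mathrm{LogPrime}(\ln(N+1))) = -\sum_{n=2}^N\mu(n) = 1-M(N).$$ 3. Each of the following conditions is equivalent to the Riemann Hypothesis: * for every $\varepsilon>0$, $|\chi(\mathrm{LogPrime}(\ln(N+1)))| = O(N^{1/2+\varepsilon})$ as $N\to\infty$ through the integers; *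 for every $\varepsilon>0$, $|\chi(\mathrm{LogPrime}(q))| = O(e^{q(1/2+\varepsilon)})$ as $q\to\infty$ through the reals; * for every $\varepsilon>0$ there is a constant $C=C(\varepsilon)>0$ such that $\ln|\chi(\mathrm{LogPrime}(q))| \le (1/2+\varepsilon)q+\ln C$ for all sufficiently large real $q$ (where $\ln 0=-\infty$). The constants implied by $O(\cdot)$ may depend on $\varepsilon$. -/

import Mathlib

open Filter Asymptotics

/-- The scalar quota complex `X[w : q]` of a positive weight function `w` on a vertex set `V` and a
quota `q`: a nonempty finite set of vertices is a face if and only if its total weight is `< q`.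
Its vertices are thus the elements of `V` of weight `< q`. -/
def quotaComplex {V : Type*} (w : V → ℝ) (hw : ∀ v, 0 < w v) (q : ℝ) :
    PreAbstractSimplicialComplex V where
  faces := {F : Finset V | F.Nonempty ∧ ∑ v ∈ F, w v < q}
  isRelLowerSet_faces := fun _ hF =>
    ⟨hF.1, fun _ hGF hG => ⟨hG, lt_of_le_of_lt
      (Finset.sum_le_sum_of_subset_of_nonneg hGF fun v _ _ => (hw v).le) hF.2⟩⟩

/-- The complex `LogPrime(q)`: the quota complex with quota `q` on the set of all primes, where the
prime `p` has weight `ln p`. -/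
noncomputable def logPrime (q : ℝ) : PreAbstractSimplicialComplex Nat.Primes :=
  quotaComplex (fun p : Nat.Primes => Real.log ((p : ℕ) : ℝ))
    (fun p => Real.log_pos (by exact_mod_cast p.2.one_lt)) q

/-- The number `c_j` of `j`-dimensional faces (those with `j + 1` vertices) of a finite complex. -/
noncomputable def numFaces {V : Type*} (K : PreAbstractSimplicialComplex V) (j : ℕ) : ℕ :=
  Set.ncard {F : Finset V | F ∈ K.faces ∧ F.card = j + 1}

/-- The Euler characteristic `χ(K) = ∑_j (-1)^j c_j` of a finite simplicial complex. -/
noncomputable def eulerCharacteristic {V : Type*} (K : PreAbstractSimplicialComplex V) : ℤ :=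
  ∑ᶠ j : ℕ, (-1 : ℤ) ^ j * (numFaces K j : ℤ)

/-- The Mertens function `M(N) = ∑_{n=1}^N μ(n)`. -/
def mertens (N : ℕ) : ℤ := ∑ n ∈ Finset.Icc 1 N, ArithmeticFunction.moebius n

/-- The finite set of integers `n` with `2 ≤ n < x`. -/
noncomputable def integersFromTwoBelow (x : ℝ) : Finset ℕ := Finset.Ico 2 ⌈x⌉₊

theorem mem_integersFromTwoBelow (x : ℝ) (n : ℕ) :
    n ∈ integersFromTwoBelow x ↔ 2 ≤ n ∧ (n : ℝ) < x := by
  simp [integersFromTwoBelow, Nat.lt_ceil]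

/-! By unique factorization, multiplying vertices identifies the faces with the squarefree integers
n in [2, e^q). A face of dimension j gives μ(n) = -(-1)^j, and other n contribute nothing. Hence χ =
1 - M(N), with N the largest integer below e^q, and each growth condition reduces to M(N) =
O(N^(1/2+ε)) for every ε > 0, whose equivalence with RH is `riemannHypothesis_iff_mertens_le`.

A power bound for M implies RH because s ∫ M(t) t^(-s-1) dt continues 1/ζ to the right of Re s = 1/2
(`riemannZeta_ne_zero_of_mertens_le`); the functional equation handles the left
(`riemannHypothesis_of_ne_zero`).

Conversely, RH gives (s - 1) ζ(s) / (s + 1) a holomorphic logarithm on Re s > 1/2; the rational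
factor cancels the pole and tends to 1 at infinity. Borel–Carathéodory bounds this logarithm by
O(log |t|), and three-lines interpolation against a line where it is bounded lowers the exponent of
log |t| below 1, whence 1/ζ(s) = O(|t|^ε) (`exists_norm_inv_riemannZeta₁_le`). A Perron formula with
kernel 1/(s(s+1)), differenced between N and N + 1, yields M(N) exactly. Moving the line to Re s =
1/2 + ε and interpolating two bounds for the kernel gives the estimate
(`mertens_le_of_riemannHypothesis`). -/

/-! ### Faces as squarefree integers, and the Euler characteristic as a Möbius sum. -/

theorem eulerCharacteristic_eq_sum {V : Type*} (K : PreAbstractSimplicialComplex V)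
    (hK : K.faces.Finite) :
    eulerCharacteristic K = ∑ F ∈ hK.toFinset, (-1 : ℤ) ^ (F.card - 1) := by
  classical
  -- Faces are nonempty, so the truncated `F.card - 1` is the true dimension.
  have hpos : ∀ F ∈ K.faces, 0 < F.card := fun F hF => (K.isRelLowerSet_faces hF).1.card_pos
  have hnum : ∀ j, numFaces K j = (hK.toFinset.filter fun F => F.card - 1 = j).card := by
    intro j
    rw [numFaces, ← Set.ncard_coe_finset]
    congr 1
    ext F
    simp only [Set.mem_ofPred_eq, Finset.coe_filter, Set.Finite.mem_toFinset]
    constructor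
    · rintro ⟨h1, h2⟩; exact ⟨h1, by omega⟩
    · rintro ⟨h1, h2⟩; exact ⟨h1, by have := hpos F h1; omega⟩
  rw [Finset.sum_comp (fun j : ℕ => (-1 : ℤ) ^ j) (fun F : Finset V => F.card - 1),
    eulerCharacteristic,
    finsum_eq_sum_of_support_subset (s := hK.toFinset.image fun F => F.card - 1)]
  · refine Finset.sum_congr rfl fun j _ => ?_
    rw [hnum, nsmul_eq_mul, mul_comm]
  · intro j hj
    simp only [Function.mem_support, hnum] at hj
    have : (hK.toFinset.filter fun F => F.card - 1 = j).card ≠ 0 := by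
      intro h; simp [h] at hj
    obtain ⟨F, hF⟩ := Finset.card_ne_zero.mp this
    rw [Finset.mem_filter] at hF
    exact Finset.mem_coe.mpr (Finset.mem_image.mpr ⟨F, hF.1, hF.2⟩)

theorem moebius_prod_primes (F : Finset Nat.Primes) :
    ArithmeticFunction.moebius (∏ p ∈ F, (p : ℕ)) = (-1) ^ F.card := by
  classical
  have h := ArithmeticFunction.isMultiplicative_moebius.map_prod_of_prime
    (F.image fun p : Nat.Primes => (p : ℕ)) (by
      intro p hp
      obtain ⟨a, _, rfl⟩ := Finset.mem_image.mp hp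
      exact a.2)
  rw [Finset.prod_image (g := fun p : Nat.Primes => (p : ℕ)) Nat.Primes.coe_nat_injective.injOn,
    Finset.prod_image (g := fun p : Nat.Primes => (p : ℕ)) Nat.Primes.coe_nat_injective.injOn] at h
  rw [h, Finset.prod_congr rfl fun p _ => ArithmeticFunction.moebius_apply_prime p.2,
    Finset.prod_const]

theorem primeFactors_prod_primes (F : Finset Nat.Primes) :
    (∏ p ∈ F, (p : ℕ)).primeFactors = F.image fun p : Nat.Primes => (p : ℕ) := by
  have h := Nat.primeFactors_prod
    (s := F.image fun p : Nat.Primes => (p : ℕ)) (by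
      intro p hp
      obtain ⟨a, _, rfl⟩ := Finset.mem_image.mp hp
      exact a.2)
  rwa [Finset.prod_image (g := fun p : Nat.Primes => (p : ℕ))
    Nat.Primes.coe_nat_injective.injOn] at h

theorem prod_primes_injective :
    Function.Injective fun F : Finset Nat.Primes => ∏ p ∈ F, (p : ℕ) := by
  intro F G h
  have := congrArg Nat.primeFactors h
  simp only [primeFactors_prod_primes] at this
  exact Finset.image_injective Nat.Primes.coe_nat_injective this

theorem exists_prod_primes_of_squarefree {n : ℕ} (hn : Squarefree n) :
    ∃ F : Finset Nat.Primes, ∏ p ∈ F, (p : ℕ) = n := by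
  refine ⟨n.primeFactors.subtype Nat.Prime, ?_⟩
  conv_rhs => rw [← Nat.prod_primeFactors_of_squarefree hn]
  exact Finset.prod_subtype_of_mem (fun p : ℕ => p) fun p hp => Nat.prime_of_mem_primeFactors hp

theorem mem_faces_logPrime (q : ℝ) (F : Finset Nat.Primes) :
    F ∈ (logPrime q).faces ↔ ∏ p ∈ F, (p : ℕ) ∈ integersFromTwoBelow (Real.exp q) := by
  have h1 : F ∈ (logPrime q).faces ↔
      F.Nonempty ∧ ∑ p ∈ F, Real.log ((p : ℕ) : ℝ) < q := Iff.rfl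
  have hpos' : 0 < ∏ p ∈ F, (p : ℕ) := Finset.prod_pos fun p _ => p.2.pos
  have hpos : (0 : ℝ) < ((∏ p ∈ F, (p : ℕ) : ℕ) : ℝ) := Nat.cast_pos.mpr hpos'
  have h2 : ∑ p ∈ F, Real.log ((p : ℕ) : ℝ) = Real.log ((∏ p ∈ F, (p : ℕ) : ℕ) : ℝ) := by
    rw [Nat.cast_prod, Real.log_prod fun p _ => Nat.cast_ne_zero.mpr p.2.ne_zero]
  rw [h1, h2, mem_integersFromTwoBelow, Real.log_lt_iff_lt_exp hpos]
  refine and_congr_left fun _ => ⟨fun ⟨p, hp⟩ => ?_, fun h => ?_⟩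
  · exact p.2.two_le.trans (Nat.le_of_dvd hpos' (Finset.dvd_prod_of_mem _ hp))
  · rw [Finset.nonempty_iff_ne_empty]
    rintro rfl
    simp at h

theorem finite_faces_logPrime (q : ℝ) : (logPrime q).faces.Finite := by
  refine Set.Finite.of_finite_image (f := fun F : Finset Nat.Primes => ∏ p ∈ F, (p : ℕ))
    ((integersFromTwoBelow (Real.exp q)).finite_toSet.subset ?_) prod_primes_injective.injOn
  rintro _ ⟨F, hF, rfl⟩
  exact (mem_faces_logPrime q F).mp hF

theorem eulerCharacteristic_logPrime (q : ℝ) :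
    eulerCharacteristic (logPrime q) =
      -∑ n ∈ integersFromTwoBelow (Real.exp q), ArithmeticFunction.moebius n := by
  rw [eulerCharacteristic_eq_sum _ (finite_faces_logPrime q), ← Finset.sum_neg_distrib]
  refine Finset.sum_of_injOn (fun F : Finset Nat.Primes => ∏ p ∈ F, (p : ℕ))
    prod_primes_injective.injOn ?_ ?_ ?_
  · intro F hF
    exact (mem_faces_logPrime q F).mp (by simpa using hF)
  · intro n hn hn'
    rw [neg_eq_zero]
    refine ArithmeticFunction.moebius_eq_zero_of_not_squarefree fun hsq => hn' ?_
    obtain ⟨F, rfl⟩ := exists_prod_primes_of_squarefree hsq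
    exact ⟨F, by simpa using (mem_faces_logPrime q F).mpr hn, rfl⟩
  · intro F hF
    have hF' : F ∈ (logPrime q).faces := by simpa using hF
    have := ((logPrime q).isRelLowerSet_faces hF').1.card_pos
    rw [moebius_prod_primes]
    obtain ⟨k, hk⟩ : ∃ k, F.card = k + 1 := ⟨F.card - 1, by omega⟩
    rw [hk, Nat.add_sub_cancel, pow_succ]
    ring

/-- The ceiling condition means N < e^q ≤ N + 1; this form serves both q = ln(N + 1) and arbitrary
real q. -/
theorem eulerCharacteristic_logPrime_eq_mertens (q : ℝ) {N : ℕ} (hN : 1 ≤ N)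
    (hq : ⌈Real.exp q⌉₊ = N + 1) :
    eulerCharacteristic (logPrime q) = -∑ n ∈ Finset.Icc 2 N, ArithmeticFunction.moebius n ∧
    eulerCharacteristic (logPrime q) = 1 - mertens N := by
  have h1 : eulerCharacteristic (logPrime q) =
      -∑ n ∈ Finset.Icc 2 N, ArithmeticFunction.moebius n := by
    rw [eulerCharacteristic_logPrime, integersFromTwoBelow, hq]
    congr 1
  refine ⟨h1, ?_⟩
  rw [h1, mertens, ← Finset.insert_Icc_add_one_left_eq_Icc hN, Finset.sum_insert (by simp)]
  simp

theorem ceil_exp_log_natCast_add_one (N : ℕ) :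
    ⌈Real.exp (Real.log ((N : ℝ) + 1))⌉₊ = N + 1 := by
  rw [Real.exp_log (by positivity)]
  exact_mod_cast Nat.ceil_natCast (R := ℝ) (N + 1)

/-! ### Integrals over (1, ∞) as analytic functions, and growth of ζ. -/

-- The integral is the Mellin transform at -s of g cut off to (1, ∞), so holomorphy follows from
-- that of Mellin transforms.
open MeasureTheory Set in
theorem differentiableAt_integral_mul_cpow {g : ℝ → ℂ} {r C : ℝ}
    (hg : Measurable g) (hC : ∀ t, 1 ≤ t → ‖g t‖ ≤ C * t ^ r)
    {s : ℂ} (hs : r < s.re) :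
    DifferentiableAt ℂ (fun s : ℂ => ∫ t in Ioi (1 : ℝ), g t * (t : ℂ) ^ (-(s + 1))) s := by
  have heq : (fun s : ℂ => ∫ t in Ioi (1 : ℝ), g t * (t : ℂ) ^ (-(s + 1))) =
      fun s => mellin ((Ioi 1).indicator g) (-s) := by
    funext s
    rw [mellin, ← integral_indicator measurableSet_Ioi, ← integral_indicator measurableSet_Ioi]
    congr 1
    funext t
    by_cases ht : t ∈ Ioi (1 : ℝ)
    · rw [indicator_of_mem ht,
        indicator_of_mem (show t ∈ Ioi (0 : ℝ) from lt_trans one_pos (mem_Ioi.mp ht)),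
        indicator_of_mem ht, smul_eq_mul, mul_comm]
      congr 2
      ring
    · rw [indicator_of_notMem ht]
      by_cases ht0 : t ∈ Ioi (0 : ℝ)
      · rw [indicator_of_mem ht0, indicator_of_notMem ht, smul_zero]
      · rw [indicator_of_notMem ht0]
  rw [heq]
  have hl : LocallyIntegrableOn ((Ioi 1).indicator g) (Ioi 0) := by
    have hc : LocallyIntegrableOn (fun t : ℝ => C * t ^ r) (Ioi 0) :=
      ContinuousOn.locallyIntegrableOn (fun t ht => (continuousAt_const.mul
        (Real.continuousAt_rpow_const _ _ (Or.inl (ne_of_gt ht)))).continuousWithinAt)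
        measurableSet_Ioi
    refine hc.mono (hg.indicator measurableSet_Ioi).aestronglyMeasurable
      (Eventually.of_forall fun t => ?_)
    by_cases ht : t ∈ Ioi (1 : ℝ)
    · rw [indicator_of_mem ht]
      exact (hC t (le_of_lt ht)).trans (Real.le_norm_self _)
    · rw [indicator_of_notMem ht, norm_zero]
      exact norm_nonneg _
  have hd : DifferentiableAt ℂ (mellin ((Ioi 1).indicator g)) (-s) := by
    -- The cut-off function vanishes near 0, so any `b` below Re(-s) would do.
    refine mellin_differentiableAt_of_isBigO_rpow (a := -r) (b := (-s).re - 1) hl ?_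
      (by simpa using hs) ?_ (by simp)
    · rw [neg_neg]
      refine IsBigO.of_bound C ?_
      filter_upwards [eventually_gt_atTop 1] with t ht
      rw [indicator_of_mem (show t ∈ Ioi (1 : ℝ) from ht),
        Real.norm_of_nonneg (Real.rpow_nonneg (by linarith) _)]
      exact hC t (le_of_lt ht)
    · refine IsBigO.of_bound 0 ?_
      filter_upwards [nhdsWithin_le_nhds (Iio_mem_nhds (one_pos : (0 : ℝ) < 1))] with t ht
      rw [indicator_of_notMem (by simpa using le_of_lt ht)]
      simp
  exact hd.comp s differentiableAt_id.neg

open Set in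
theorem eqOn_halfPlane_of_eqOn_halfPlane {f g : ℂ → ℂ} {r r' : ℝ}
    (hf : ∀ s : ℂ, r < s.re → DifferentiableAt ℂ f s)
    (hg : ∀ s : ℂ, r < s.re → DifferentiableAt ℂ g s)
    (h : ∀ s : ℂ, r' < s.re → f s = g s) {s : ℂ} (hs : r < s.re) : f s = g s := by
  have hopen : ∀ a : ℝ, IsOpen {s : ℂ | a < s.re} := fun a =>
    isOpen_lt continuous_const Complex.continuous_re
  have han : ∀ {k : ℂ → ℂ}, (∀ s : ℂ, r < s.re → DifferentiableAt ℂ k s) →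
      AnalyticOnNhd ℂ k {s : ℂ | r < s.re} := fun hk =>
    DifferentiableOn.analyticOnNhd (fun s hs => (hk s hs).differentiableWithinAt) (hopen r)
  have hmem : ((max r r' + 1 : ℝ) : ℂ) ∈ {s : ℂ | r < s.re} := by
    simpa using (le_max_left r r').trans_lt (lt_add_one _)
  have hpre : IsPreconnected {s : ℂ | r < s.re} :=
    (convex_halfSpace_re_gt r).isPreconnected
  refine (han hf).eqOn_of_preconnected_of_eventuallyEq (han hg) hpre hmem ?_ hs
  filter_upwards [(hopen r').mem_nhds (show ((max r r' + 1 : ℝ) : ℂ) ∈ {s : ℂ | r' < s.re} by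
    simpa using (le_max_right r r').trans_lt (lt_add_one _))] with z hz
  exact h z hz

-- Abel summation of ∑ n^(-s): the partial sums of the coefficients are ⌊t⌋.
open MeasureTheory Set in
theorem riemannZeta_eq_mul_integral_floor {s : ℂ} (hs : 1 < s.re) :
    riemannZeta s = s * ∫ t in Ioi (1 : ℝ), (⌊t⌋₊ : ℂ) * (t : ℂ) ^ (-(s + 1)) := by
  rw [← LSeries_one_eq_riemannZeta hs, LSeries_eq_mul_integral 1 zero_le_one hs
    (LSeriesSummable_one_iff.mpr hs)]
  · simp
  · exact IsBigO.of_bound 1 (Eventually.of_forall fun n => by simp)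

open MeasureTheory Set in
theorem integrableOn_mul_cpow_and_norm_integral_le {g : ℝ → ℂ} {r C : ℝ} (hg : Measurable g)
    (hC : ∀ t, 1 ≤ t → ‖g t‖ ≤ C * t ^ r) {s : ℂ} (hs : r < s.re) :
    IntegrableOn (fun t : ℝ => g t * (t : ℂ) ^ (-(s + 1))) (Ioi 1) ∧
    ‖∫ t in Ioi (1 : ℝ), g t * (t : ℂ) ^ (-(s + 1))‖ ≤ C / (s.re - r) := by
  have hI : IntegrableOn (fun t : ℝ => C * t ^ (r - s.re - 1)) (Ioi 1) :=
    (integrableOn_Ioi_rpow_of_lt (by linarith) one_pos).const_mul _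
  have hb : ∀ t ∈ Ioi (1 : ℝ), ‖g t * (t : ℂ) ^ (-(s + 1))‖ ≤ C * t ^ (r - s.re - 1) := by
    intro t (ht : 1 < t)
    have ht0 : 0 < t := by linarith
    rw [norm_mul, Complex.norm_cpow_eq_rpow_re_of_pos ht0,
      show r - s.re - 1 = r + (-(s + 1)).re by simp; ring, Real.rpow_add ht0, ← mul_assoc]
    exact mul_le_mul_of_nonneg_right (hC t ht.le) (Real.rpow_nonneg ht0.le _)
  have hm : AEStronglyMeasurable (fun t : ℝ => g t * (t : ℂ) ^ (-(s + 1)))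
      (volume.restrict (Ioi 1)) :=
    (hg.mul (Complex.measurable_ofReal.pow_const _)).aestronglyMeasurable
  have hae := (ae_restrict_iff' (μ := volume) measurableSet_Ioi).mpr (Eventually.of_forall hb)
  refine ⟨hI.mono' hm hae, ?_⟩
  refine (norm_integral_le_of_norm_le hI hae).trans_eq ?_
  rw [integral_const_mul, integral_Ioi_rpow_of_lt (by linarith) one_pos, Real.one_rpow]
  rw [show r - s.re - 1 + 1 = -(s.re - r) by ring, neg_div_neg_eq, mul_one_div]

-- For Re s > 1, split ⌊t⌋ = t - {t} in Abel's integral. The fractional-part integral is holomorphic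
-- on Re s > 0, so the identity theorem extends the formula there.
open MeasureTheory Set in
theorem riemannZeta₁_eq_sub_integral_fract {s : ℂ} (hs : 0 < s.re) :
    riemannZeta₁ s = s - s * (s - 1) *
      ∫ t in Ioi (1 : ℝ), ((Int.fract t : ℝ) : ℂ) * (t : ℂ) ^ (-(s + 1)) := by
  have hmeas : Measurable fun t : ℝ => ((Int.fract t : ℝ) : ℂ) :=
    Complex.measurable_ofReal.comp measurable_fract
  have hbd : ∀ t : ℝ, 1 ≤ t → ‖((Int.fract t : ℝ) : ℂ)‖ ≤ 1 * t ^ (0 : ℝ) := fun t _ => by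
    rw [Complex.norm_real, Real.norm_of_nonneg (Int.fract_nonneg t), Real.rpow_zero, mul_one]
    exact (Int.fract_lt_one t).le
  refine eqOn_halfPlane_of_eqOn_halfPlane (r := 0) (r' := 1)
    (g := fun s => s - s * (s - 1) *
      ∫ t in Ioi (1 : ℝ), ((Int.fract t : ℝ) : ℂ) * (t : ℂ) ^ (-(s + 1)))
    (fun s _ => differentiable_riemannZeta₁ s) (fun s hs => ?_) (fun s hs => ?_) hs
  · exact differentiableAt_id.sub ((differentiableAt_id.mul (differentiableAt_id.sub_const 1)).mul
      (differentiableAt_integral_mul_cpow hmeas hbd hs))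
  · have hs1 : s - 1 ≠ 0 := by
      intro h
      rw [sub_eq_zero.mp h] at hs
      simp at hs
    have h1 : riemannZeta₁ s = (s - 1) * riemannZeta s := by
      rw [riemannZeta_eq_inv_sub_mul (sub_ne_zero.mp hs1), mul_inv_cancel_left₀ hs1]
    have hid := integrableOn_mul_cpow_and_norm_integral_le (g := fun t : ℝ => (t : ℂ))
      (r := 1) (C := 1)
      Complex.measurable_ofReal (fun t ht => by
        rw [Complex.norm_real, Real.norm_of_nonneg (by linarith), Real.rpow_one, one_mul]) hs
    have hfr := integrableOn_mul_cpow_and_norm_integral_le hmeas hbd (show 0 < s.re by linarith)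
    have hsplit : ∫ t in Ioi (1 : ℝ), (⌊t⌋₊ : ℂ) * (t : ℂ) ^ (-(s + 1)) =
        1 / (s - 1) - ∫ t in Ioi (1 : ℝ), ((Int.fract t : ℝ) : ℂ) * (t : ℂ) ^ (-(s + 1)) := by
      have h2 : ∫ t in Ioi (1 : ℝ), (t : ℂ) * (t : ℂ) ^ (-(s + 1)) = 1 / (s - 1) := by
        have : ∫ t in Ioi (1 : ℝ), (t : ℂ) * (t : ℂ) ^ (-(s + 1)) =
            ∫ t in Ioi (1 : ℝ), (t : ℂ) ^ (-s) := by
          refine setIntegral_congr_fun measurableSet_Ioi fun t (ht : 1 < t) => ?_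
          have ht0 : (t : ℂ) ≠ 0 := by exact_mod_cast (by linarith : t ≠ 0)
          rw [show -s = 1 + -(s + 1) by ring, Complex.cpow_add _ _ ht0, Complex.cpow_one]
        rw [this, integral_Ioi_cpow_of_lt (by simpa using hs) one_pos]
        simp only [Complex.ofReal_one, Complex.one_cpow]
        rw [show -s + 1 = -(s - 1) by ring, neg_div_neg_eq]
      rw [← h2, ← integral_sub hid.1 hfr.1]
      refine setIntegral_congr_fun measurableSet_Ioi fun t (ht : 1 < t) => ?_
      have : (⌊t⌋₊ : ℂ) = (t : ℂ) - ((Int.fract t : ℝ) : ℂ) := by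
        rw [← Complex.ofReal_sub, Int.self_sub_fract, ← Complex.ofReal_natCast,
          natCast_floor_eq_intCast_floor (by linarith)]
      simp only [this, sub_mul]
    rw [h1, riemannZeta_eq_mul_integral_floor hs, hsplit]
    field_simp

/-- The fractional-part integral is at most 1/Re s ≤ 2. Polynomial growth is all that is needed,
since the bound is used through its logarithm. -/
theorem norm_riemannZeta₁_le {s : ℂ} (hs : 1 / 2 ≤ s.re) :
    ‖riemannZeta₁ s‖ ≤ 3 * (‖s‖ + 1) ^ 2 := by
  have h0 : 0 < s.re := by linarith
  have hint := (integrableOn_mul_cpow_and_norm_integral_le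
    (g := fun t : ℝ => ((Int.fract t : ℝ) : ℂ)) (r := 0) (C := 1)
    (Complex.measurable_ofReal.comp measurable_fract) (fun t _ => by
      rw [Complex.norm_real, Real.norm_of_nonneg (Int.fract_nonneg t), Real.rpow_zero, mul_one]
      exact (Int.fract_lt_one t).le) h0).2
  have h2 : 1 / (s.re - 0) ≤ 2 := by
    rw [sub_zero, div_le_iff₀ h0]; linarith
  rw [riemannZeta₁_eq_sub_integral_fract h0]
  refine (norm_sub_le _ _).trans ?_
  rw [norm_mul, norm_mul]
  have h1 : ‖s - 1‖ ≤ ‖s‖ + 1 := by simpa using norm_sub_le s 1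
  have hs0 := norm_nonneg s
  have h3 : ‖s‖ * ‖s - 1‖ ≤ ‖s‖ * (‖s‖ + 1) := mul_le_mul_of_nonneg_left h1 hs0
  have h4 := mul_le_mul h3 (hint.trans h2) (norm_nonneg _) (by positivity)
  nlinarith

/-! ### From bounds on the Mertens function to the Riemann hypothesis. -/

/-- A power bound for the Mertens function keeps `ζ` from vanishing to the right of it. -/
theorem riemannZeta_ne_zero_of_mertens_le {ρ C : ℝ} (hρ : 0 ≤ ρ)
    (hC : ∀ N : ℕ, 1 ≤ N → |(mertens N : ℝ)| ≤ C * (N : ℝ) ^ ρ) {s : ℂ} (hs : ρ < s.re)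
    (hs1 : s ≠ 1) : riemannZeta s ≠ 0 := by
  have hC0 : 0 ≤ C := by
    simpa using (abs_nonneg _).trans (hC 1 le_rfl)
  have hmeas : Measurable fun t : ℝ => (mertens ⌊t⌋₊ : ℂ) :=
    (measurable_from_nat (f := fun n : ℕ => (mertens n : ℂ))).comp Nat.measurable_floor
  have hbd : ∀ t : ℝ, 1 ≤ t → ‖(mertens ⌊t⌋₊ : ℂ)‖ ≤ C * t ^ ρ := fun t ht => by
    rw [Complex.norm_intCast]
    refine (hC _ (Nat.one_le_floor_iff _ |>.mpr ht)).trans ?_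
    gcongr
    exact Nat.floor_le (by linarith)
  -- For Re s > 1 the integral factor is 1/ζ, so the product is s - 1. The identity persists up to
  -- Re s > ρ, where a zero of `riemannZeta₁` would force s = 1.
  have key := eqOn_halfPlane_of_eqOn_halfPlane (r := ρ) (r' := 1)
    (f := fun s => s * (∫ t in Set.Ioi (1 : ℝ), (mertens ⌊t⌋₊ : ℂ) * (t : ℂ) ^ (-(s + 1))) *
      riemannZeta₁ s) (g := fun s => s - 1)
    (fun s hs => (differentiableAt_id.mul (differentiableAt_integral_mul_cpow hmeas hbd hs)).mul
      (differentiable_riemannZeta₁ s)) (fun s _ => differentiableAt_id.sub_const 1)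
    (fun s hs => ?_) hs
  · intro hz
    rw [riemannZeta_eq_inv_sub_mul hs1, mul_eq_zero] at hz
    have h1 : s - 1 ≠ 0 := sub_ne_zero.mpr hs1
    rcases hz with hz | hz
    · exact h1 (inv_eq_zero.mp hz)
    · simp only [hz, mul_zero] at key
      exact h1 key.symm
  · have hs1' : s ≠ 1 := by rintro rfl; simp at hs
    have h1 : s - 1 ≠ 0 := sub_ne_zero.mpr hs1'
    have hone := ArithmeticFunction.LSeries_zeta_mul_Lseries_moebius hs
    rw [ArithmeticFunction.LSeries_zeta_eq_riemannZeta hs, LSeries_eq_mul_integral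
      (fun n => ((ArithmeticFunction.moebius n : ℤ) : ℂ)) zero_le_one hs
      (ArithmeticFunction.LSeriesSummable_moebius_iff.mpr hs), riemannZeta_eq_inv_sub_mul hs1'] at hone
    · have hM : ∀ t : ℝ, ∑ k ∈ Finset.Icc 1 ⌊t⌋₊, ((ArithmeticFunction.moebius k : ℤ) : ℂ) =
          (mertens ⌊t⌋₊ : ℂ) := fun t => by rw [mertens]; push_cast; rfl
      simp only [hM] at hone
      field_simp at hone
      rw [← hone]
      ring
    · refine IsBigO.of_bound 1 (Eventually.of_forall fun n => ?_)
      rw [Real.rpow_one, one_mul, Real.norm_natCast]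
      refine (norm_sum_le _ _).trans ((Finset.sum_le_sum (g := fun _ => (1 : ℝ)) fun k _ => ?_).trans
        (by simp))
      rw [Complex.norm_intCast]
      exact_mod_cast ArithmeticFunction.abs_moebius_le_one

/-- The functional equation reflects a zero left of the critical line to one on its right. It is
unavailable in that form at the nonpositive integers, which are treated by hand. -/
theorem riemannHypothesis_of_ne_zero
    (h : ∀ s : ℂ, 1 / 2 < s.re → s ≠ 1 → riemannZeta s ≠ 0) : RiemannHypothesis := by
  intro s hs htriv hs1
  by_contra hne
  rcases lt_or_gt_of_ne hne with hlt | hgt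
  · by_cases hn : ∃ n : ℕ, s = -n
    · obtain ⟨n, rfl⟩ := hn
      rcases Nat.even_or_odd' n with ⟨k, rfl | rfl⟩
      · rcases k with _ | k
        · simp [riemannZeta_zero] at hs
        · exact htriv ⟨k, by push_cast; ring⟩
      -- A negative odd integer is 1 - (2k + 2), and no factor of the functional equation vanishes
      -- at 2k + 2.
      · have hfe := riemannZeta_one_sub (s := (2 * k + 2 : ℕ)) (fun m hm => by
            have h1 := congrArg Complex.re hm
            simp at h1
            have : (0 : ℝ) ≤ m := m.cast_nonneg
            have : (0 : ℝ) ≤ k := k.cast_nonneg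
            linarith) (by norm_cast; omega)
        rw [show (1 : ℂ) - ((2 * k + 2 : ℕ) : ℂ) = -((2 * k + 1 : ℕ) : ℂ) by push_cast; ring,
          hs] at hfe
        have hπ : (2 * (Real.pi : ℂ)) ≠ 0 := by simp [Real.pi_ne_zero]
        have hcos : Complex.cos (Real.pi * ((2 * k + 2 : ℕ) : ℂ) / 2) ≠ 0 := by
          rw [show (Real.pi : ℂ) * ((2 * k + 2 : ℕ) : ℂ) / 2 =
            (((k + 1 : ℕ) * Real.pi : ℝ) : ℂ) by push_cast; ring, ← Complex.ofReal_cos,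
            Real.cos_nat_mul_pi]
          exact Complex.ofReal_ne_zero.mpr (pow_ne_zero _ (by norm_num))
        have hΓ : Complex.Gamma ((2 * k + 2 : ℕ) : ℂ) ≠ 0 :=
          Complex.Gamma_ne_zero_of_re_pos (by
            rw [Complex.natCast_re]; positivity)
        have hζ : riemannZeta ((2 * k + 2 : ℕ) : ℂ) ≠ 0 :=
          riemannZeta_ne_zero_of_one_le_re (by
            rw [Complex.natCast_re]; exact_mod_cast (by omega : 1 ≤ 2 * k + 2))
        exact mul_ne_zero (mul_ne_zero (mul_ne_zero (mul_ne_zero two_ne_zero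
          ((Complex.cpow_ne_zero_iff_of_exponent_ne_zero (by
            rw [neg_ne_zero]; norm_cast)).mpr hπ)) hΓ) hcos) hζ hfe.symm
    · push Not at hn
      refine h (1 - s) (by simp; linarith) (fun h1 => hn 0 (by simpa using h1)) ?_
      rw [riemannZeta_one_sub hn hs1, hs, mul_zero]
  · exact h s hgt hs1 hs

/-! ### The logarithm of ζ and the growth of 1/ζ under the Riemann hypothesis. -/

theorem riemannZeta₁_ne_zero (hRH : RiemannHypothesis) {s : ℂ} (hs : 1 / 2 < s.re) :
    riemannZeta₁ s ≠ 0 := by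
  by_cases hs1 : s = 1
  · simp [hs1]
  · intro h0
    have := hRH s (by rw [riemannZeta_eq_inv_sub_mul hs1, h0, mul_zero]) (by
      rintro ⟨n, rfl⟩
      simp at hs
      have : (0 : ℝ) ≤ n := n.cast_nonneg
      linarith) hs1
    linarith

-- A convex set is simply connected, so f has a continuous logarithm. Near z it is the principal
-- logarithm of f(w)/f(z) plus a constant, hence holomorphic.
open Set in
theorem Convex.exists_differentiableOn_log {U : Set ℂ} (hU : Convex ℝ U) (hUo : IsOpen U)
    (hne : U.Nonempty) {f : ℂ → ℂ} (hf : DifferentiableOn ℂ f U) (h0 : ∀ z ∈ U, f z ≠ 0) :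
    ∃ h : ℂ → ℂ, DifferentiableOn ℂ h U ∧ ∀ z ∈ U, Complex.exp (h z) = f z := by
  have hsc : IsSimplyConnected U := by
    have := hU.contractibleSpace hne
    exact SimplyConnectedSpace.ofContractible U
  obtain ⟨h, hc, he⟩ := Complex.exists_continuousOn_eqOn_exp_comp hsc hUo hf.continuousOn (by
    rintro ⟨z, hz, hz0⟩
    exact h0 z hz hz0)
  refine ⟨h, fun z hz => DifferentiableAt.differentiableWithinAt ?_, he⟩
  have hfz : DifferentiableAt ℂ f z := (hf z hz).differentiableAt (hUo.mem_nhds hz)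
  have hhz : ContinuousAt h z := hc.continuousAt (hUo.mem_nhds hz)
  have hlog : DifferentiableAt ℂ (fun w => Complex.log (f w / f z) + h z) z :=
    ((hfz.div_const _).clog (by simp [h0 z hz])).add_const _
  refine hlog.congr_of_eventuallyEq ?_
  have him : ∀ᶠ w in nhds z, (h w - h z).im ∈ Ioo (-Real.pi) Real.pi := by
    have : ContinuousAt (fun w => (h w - h z).im) z :=
      Complex.continuous_im.continuousAt.comp (hhz.sub continuousAt_const)
    refine this.eventually_mem (Ioo_mem_nhds ?_ ?_) <;> simp [Real.pi_pos]
  filter_upwards [him, hUo.mem_nhds hz] with w hw hwU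
  rw [← he hwU, ← he hz, Function.comp_apply, Function.comp_apply, ← Complex.exp_sub,
    Complex.log_exp hw.1 hw.2.le, sub_add_cancel]

/-- Termwise comparison with ζ(2) - 1 = π²/6 - 1. A bound below 1 puts ζ(s) in the domain of the
principal logarithm. -/
theorem norm_riemannZeta_sub_one_le {s : ℂ} (hs : 2 ≤ s.re) : ‖riemannZeta s - 1‖ ≤ 2 / 3 := by
  have hterm : ∀ n : ℕ, ‖1 / ((n : ℂ) + 1) ^ s‖ ≤ 1 / ((n : ℝ) + 1) ^ 2 := fun n => by
    have hn : (0 : ℝ) < (n : ℝ) + 1 := by positivity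
    rw [norm_div, norm_one, show (n : ℂ) + 1 = (((n : ℝ) + 1 : ℝ) : ℂ) by push_cast; rfl,
      Complex.norm_cpow_eq_rpow_re_of_pos hn]
    refine one_div_le_one_div_of_le (by positivity) ?_
    rw [← Real.rpow_two]
    exact Real.rpow_le_rpow_of_exponent_le (by linarith [n.cast_nonneg (α := ℝ)]) hs
  have hsum2 : HasSum (fun n : ℕ => 1 / ((n : ℝ) + 1) ^ 2) (Real.pi ^ 2 / 6) := by
    have := (hasSum_nat_add_iff' (f := fun n : ℕ => 1 / (n : ℝ) ^ 2) 1).mpr hasSum_zeta_two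
    simpa using this
  have hsumm : Summable fun n : ℕ => 1 / ((n : ℂ) + 1) ^ s :=
    Summable.of_norm_bounded hsum2.summable hterm
  have h1 := (hasSum_nat_add_iff' 1).mpr hsumm.hasSum
  have h2 := (hasSum_nat_add_iff' 1).mpr hsum2
  rw [← zeta_eq_tsum_one_div_nat_add_one_cpow (by linarith)] at h1
  simp only [Finset.range_one, Finset.sum_singleton, Nat.cast_zero, zero_add, Complex.one_cpow,
    div_one, one_pow] at h1 h2
  rw [← h1.tsum_eq]
  refine (tsum_of_norm_bounded h2 fun n => hterm (n + 1)).trans ?_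
  nlinarith [Real.pi_pos, Real.pi_lt_d2]

theorem norm_log_one_add_le_two {z : ℂ} (hz : ‖z‖ ≤ 2 / 3) : ‖Complex.log (1 + z)‖ ≤ 2 := by
  refine (Complex.norm_log_one_add_le (by linarith)).trans ?_
  have h1 : (1 - ‖z‖)⁻¹ ≤ 3 := by
    rw [inv_le_comm₀ (by linarith) (by norm_num)]; linarith
  have h2 : ‖z‖ ^ 2 ≤ 4 / 9 := by nlinarith [norm_nonneg z]
  have h3 : ‖z‖ ^ 2 * (1 - ‖z‖)⁻¹ ≤ 4 / 9 * 3 :=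
    mul_le_mul h2 h1 (inv_nonneg.mpr (by linarith)) (by norm_num)
  linarith

/-- Under the Riemann hypothesis `(s - 1) ζ(s) / (s + 1)` has a logarithm on `Re s > 1 / 2`, and that
logarithm is bounded on `Re s > 2`. -/
theorem exists_log_riemannZeta₁_div (hRH : RiemannHypothesis) :
    ∃ h : ℂ → ℂ, DifferentiableOn ℂ h {s | 1 / 2 < s.re} ∧
      (∀ s : ℂ, 1 / 2 < s.re → Complex.exp (h s) = riemannZeta₁ s / (s + 1)) ∧
      ∃ B : ℝ, 0 ≤ B ∧ ∀ s : ℂ, 2 < s.re → ‖h s‖ ≤ B := by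
  have hne1 : ∀ s : ℂ, 0 < s.re → s + 1 ≠ 0 := fun s hs h => by
    have := congrArg Complex.re h
    simp at this
    linarith
  obtain ⟨h, hd, he⟩ := (convex_halfSpace_re_gt (1 / 2)).exists_differentiableOn_log
    (isOpen_lt continuous_const Complex.continuous_re) ⟨1, by norm_num⟩
    (f := fun s => riemannZeta₁ s / (s + 1))
    (fun s (hs : 1 / 2 < s.re) => ((differentiable_riemannZeta₁ s).div
      (differentiableAt_id.add_const 1) (hne1 s (by linarith))).differentiableWithinAt)
    (fun s (hs : 1 / 2 < s.re) => div_ne_zero (riemannZeta₁_ne_zero hRH hs)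
      (hne1 s (by linarith)))
  refine ⟨h, hd, he, ?_⟩
  have hopen : IsOpen {s : ℂ | 2 < s.re} := isOpen_lt continuous_const Complex.continuous_re
  have hq : ∀ s : ℂ, 2 < s.re → ‖-2 / (s + 1)‖ ≤ 2 / 3 := fun s hs => by
    have : 3 ≤ ‖s + 1‖ := by
      refine le_trans ?_ (Complex.re_le_norm _)
      simp
      linarith
    rw [norm_div, norm_neg, Complex.norm_ofNat]
    gcongr
  have hslit : ∀ z : ℂ, ‖z‖ ≤ 2 / 3 → 1 + z ∈ Complex.slitPlane := fun z hz =>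
    Complex.mem_slitPlane_of_norm_lt_one (by linarith)
  -- Since (s - 1)/(s + 1) = 1 - 2/(s + 1), the subtracted sum is another logarithm of the same
  -- function, bounded by 4. Thus exp c = 1, and c is constant on Re s > 2.
  let c : ℂ → ℂ := fun s => h s -
    (Complex.log (1 + (riemannZeta s - 1)) + Complex.log (1 + -2 / (s + 1)))
  have hc : DifferentiableOn ℂ c {s : ℂ | 2 < s.re} := by
    intro s (hs : 2 < s.re)
    refine DifferentiableAt.differentiableWithinAt ?_
    have hs1 : s ≠ 1 := by
      rintro rfl
      norm_num at hs
    refine DifferentiableAt.sub ?_ (DifferentiableAt.add ?_ ?_)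
    · exact (hd s (by simp only [Set.mem_ofPred_eq]; linarith)).differentiableAt
        ((isOpen_lt continuous_const Complex.continuous_re).mem_nhds
          (by simp only [Set.mem_ofPred_eq]; linarith))
    · exact (((differentiableAt_riemannZeta hs1).sub_const 1).const_add 1).clog
        (hslit _ (norm_riemannZeta_sub_one_le hs.le))
    · have h2 := hne1 s (by linarith)
      have h3 : DifferentiableAt ℂ (fun s : ℂ => 1 + -2 / (s + 1)) s := by
        fun_prop (disch := assumption)
      exact h3.clog (hslit _ (hq s hs))
  have hexp : ∀ s : ℂ, 2 < s.re → Complex.exp (c s) = 1 := by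
    intro s hs
    have hs1 : s ≠ 1 := by
      rintro rfl
      norm_num at hs
    have h1 : s - 1 ≠ 0 := sub_ne_zero.mpr hs1
    have h2 := hne1 s (by linarith)
    have h3 : riemannZeta₁ s ≠ 0 := riemannZeta₁_ne_zero hRH (by linarith)
    have h4 : (1 : ℂ) + -2 / (s + 1) = (s - 1) / (s + 1) := by
      field_simp
      ring
    rw [Complex.exp_sub, Complex.exp_add, he s (show 1 / 2 < s.re by linarith),
      Complex.exp_log (Complex.slitPlane_ne_zero (hslit _ (norm_riemannZeta_sub_one_le hs.le))),
      Complex.exp_log (Complex.slitPlane_ne_zero (hslit _ (hq s hs))), h4, add_sub_cancel,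
      riemannZeta_eq_inv_sub_mul hs1]
    field_simp
  obtain ⟨a, ha⟩ := hopen.exists_is_const_of_deriv_eq_zero
    (convex_halfSpace_re_gt 2).isPreconnected hc (fun s (hs : 2 < s.re) => by
      have hcs := (hc s hs).differentiableAt (hopen.mem_nhds hs)
      have h1 : (fun s => Complex.exp (c s)) =ᶠ[nhds s] fun _ => 1 := by
        filter_upwards [hopen.mem_nhds hs] with z hz using hexp z hz
      have h2 := h1.deriv_eq
      rw [hcs.hasDerivAt.cexp.deriv, deriv_const, hexp s hs, one_mul] at h2
      exact h2)
  refine ⟨‖a‖ + 4, by positivity, fun s hs => ?_⟩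
  have h1 : h s = a + (Complex.log (1 + (riemannZeta s - 1)) +
      Complex.log (1 + -2 / (s + 1))) := by
    rw [← ha s hs]
    ring
  rw [h1]
  have h2 := norm_log_one_add_le_two (norm_riemannZeta_sub_one_le hs.le)
  have h3 := norm_log_one_add_le_two (hq s hs)
  have h4 := norm_add_le a (Complex.log (1 + (riemannZeta s - 1)) +
      Complex.log (1 + -2 / (s + 1)))
  have h5 := norm_add_le (Complex.log (1 + (riemannZeta s - 1)))
      (Complex.log (1 + -2 / (s + 1)))
  linarith

/-- Borel–Carathéodory bound for a logarithm of `(s - 1) ζ(s) / (s + 1)`. -/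
theorem exists_norm_log_le_mul_log {h : ℂ → ℂ} (hd : DifferentiableOn ℂ h {s | 1 / 2 < s.re})
    (he : ∀ s : ℂ, 1 / 2 < s.re → Complex.exp (h s) = riemannZeta₁ s / (s + 1))
    {B : ℝ} (hB0 : 0 ≤ B) (hB : ∀ s : ℂ, 2 < s.re → ‖h s‖ ≤ B) {δ : ℝ} (hδ : 0 < δ) :
    ∃ A : ℝ, 0 < A ∧ ∀ s : ℂ, 1 / 2 + δ ≤ s.re → s.re ≤ 3 →
      ‖h s‖ ≤ A * Real.log (|s.im| + 7) := by
  -- Borel–Carathéodory with M = 4L, R = 5/2 and r = 3 - Re s ≤ 5/2 has numerator at most 20L + 5B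
  -- and denominator R - r ≥ δ; L ≥ 1 absorbs B.
  refine ⟨(20 + 5 * B) / δ, by positivity, fun s hs1 hs3 => ?_⟩
  set T := s.im with hT
  have hT0 : 0 ≤ |T| := abs_nonneg T
  set L := Real.log (|T| + 7) with hL
  have hL1 : 1 ≤ L := by
    rw [hL, Real.le_log_iff_exp_le (by positivity)]
    linarith [Real.exp_one_lt_d9]
  -- The disc of radius 5/2 about 3 + iT just reaches the line Re s = 1/2, and h is bounded at its
  -- centre.
  let c : ℂ := ⟨3, T⟩
  have hre : ∀ z ∈ Metric.ball (0 : ℂ) (5 / 2), 1 / 2 < (c + z).re := fun z hz => by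
    rw [mem_ball_zero_iff] at hz
    have := (abs_le.mp (Complex.abs_re_le_norm z)).1
    simp only [c, Complex.add_re]
    linarith
  have hz : ‖s - c‖ = 3 - s.re := by
    have : s - c = ((s.re - 3 : ℝ) : ℂ) := by
      apply Complex.ext <;> simp [c, hT]
    rw [this, Complex.norm_real, Real.norm_of_nonpos (by linarith)]
    ring
  have key := Complex.borelCaratheodory (f := fun z => h (c + z)) (M := 4 * L) (R := 5 / 2)
    (z := s - c) (by positivity) ?_ ?_ (by norm_num)
    (by rw [mem_ball_zero_iff, hz]; linarith)
  · simp only [add_sub_cancel, add_zero, hz] at key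
    have hc : ‖h c‖ ≤ B := hB c (by simp [c]; norm_num)
    have hden : δ ≤ 5 / 2 - (3 - s.re) := by linarith
    have hden0 : 0 < 5 / 2 - (3 - s.re) := by linarith
    refine key.trans ?_
    rw [← add_div, div_mul_eq_mul_div]
    refine div_le_div₀ (by positivity) ?_ hδ hden
    have h1 : ‖h c‖ * (5 / 2 + (3 - s.re)) ≤ B * 5 :=
      mul_le_mul hc (by linarith) (by linarith) hB0
    have h2 : 2 * (4 * L) * (3 - s.re) ≤ 2 * (4 * L) * (5 / 2) :=
      mul_le_mul_of_nonneg_left (by linarith) (by positivity)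
    nlinarith
  · intro z hz
    have hopen : IsOpen {s : ℂ | 1 / 2 < s.re} :=
      isOpen_lt continuous_const Complex.continuous_re
    have h1 : DifferentiableAt ℂ h (c + z) :=
      (hd _ (hre z hz)).differentiableAt (hopen.mem_nhds (hre z hz))
    exact (h1.comp z (differentiableAt_id.const_add c)).differentiableWithinAt
  · intro z hz
    have hre' := hre z hz
    have hns : ‖c + z‖ ≤ |T| + 11 / 2 := by
      rw [mem_ball_zero_iff] at hz
      have hc : ‖c‖ ≤ 3 + |T| := by simpa [c] using Complex.norm_le_abs_re_add_abs_im c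
      linarith [norm_add_le c z]
    have h1 : 1 ≤ ‖c + z + 1‖ := by
      refine le_trans ?_ (Complex.re_le_norm _)
      rw [Complex.add_re, Complex.one_re]
      linarith
    -- A bound for |exp h| bounds Re h from above, which is all Borel–Carathéodory asks. The shift 7
    -- covers |c + z| + 1 ≤ |T| + 13/2, and the exponent 4 absorbs the factor 3.
    have h2 : ‖Complex.exp (h (c + z))‖ ≤ (|T| + 7) ^ 4 := by
      rw [he _ hre', norm_div]
      refine (div_le_self (norm_nonneg _) h1).trans ((norm_riemannZeta₁_le hre'.le).trans ?_)
      have h3 : (‖c + z‖ + 1) ^ 2 ≤ (|T| + 7) ^ 2 :=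
        pow_le_pow_left₀ (by positivity) (by linarith) 2
      have h4 : (3 : ℝ) ≤ (|T| + 7) ^ 2 := by nlinarith
      nlinarith [sq_nonneg (|T| + 7)]
    rw [Complex.norm_exp] at h2
    change (h (c + z)).re ≤ 4 * L
    rw [hL, ← Real.exp_le_exp]
    refine h2.trans_eq ?_
    rw [mul_comm, Real.exp_mul, Real.exp_log (by positivity)]
    norm_cast

open Complex.HadamardThreeLines in
/-- Three lines bound, with a Gaussian weight centred at the height of the point. -/
theorem exists_norm_log_le_mul_rpow {h : ℂ → ℂ} (hd : DifferentiableOn ℂ h {s | 1 / 2 < s.re})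
    (he : ∀ s : ℂ, 1 / 2 < s.re → Complex.exp (h s) = riemannZeta₁ s / (s + 1))
    {B : ℝ} (hB0 : 0 ≤ B) (hB : ∀ s : ℂ, 2 < s.re → ‖h s‖ ≤ B) {δ : ℝ} (hδ : 0 < δ)
    (hδ1 : δ ≤ 1) :
    ∃ K : ℝ, 0 < K ∧ ∀ s : ℂ, 1 / 2 + 2 * δ ≤ s.re →
      ‖h s‖ ≤ K * Real.log (|s.im| + 7) ^ (1 - 2 * δ / 5) := by
  obtain ⟨A, hA0, hA⟩ := exists_norm_log_le_mul_log hd he hB0 hB hδ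
  refine ⟨2 * A * Real.exp 9 + B * Real.exp 9, by positivity, fun s hs => ?_⟩
  set T := s.im with hT
  have hT0 : 0 ≤ |T| := abs_nonneg T
  set L := Real.log (|T| + 7) with hL
  have hL1 : 1 ≤ L := by
    rw [hL, Real.le_log_iff_exp_le (by positivity)]
    linarith [Real.exp_one_lt_d9]
  set K := 2 * A * Real.exp 9 + B * Real.exp 9 with hK
  have hBK : B ≤ K := by
    have : B * 1 ≤ B * Real.exp 9 := mul_le_mul_of_nonneg_left (Real.one_le_exp (by norm_num)) hB0
    have : 0 < 2 * A * Real.exp 9 := by positivity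
    linarith
  have hK0 : 0 < K := by positivity
  by_cases hs3 : 3 < s.re
  · refine (hB s (by linarith)).trans (hBK.trans ?_)
    exact le_mul_of_one_le_right hK0.le (Real.one_le_rpow hL1 (by linarith))
  push Not at hs3
  -- The weight has modulus exp(x² - (y - T)²): its decay away from height T beats the growth of log
  -- |y|, so g is bounded by a multiple of L on the whole strip, while at s the weight is at least
  -- 1.
  let g : ℂ → ℂ := fun z => h z * Complex.exp ((z - T * Complex.I) ^ 2)
  have hw : ∀ z : ℂ, ‖Complex.exp ((z - T * Complex.I) ^ 2)‖ =
      Real.exp (z.re ^ 2 - (z.im - T) ^ 2) := fun z => by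
    rw [Complex.norm_exp]
    congr 1
    simp [sq]
  have hgd : DifferentiableOn ℂ g {s | 1 / 2 < s.re} := hd.mul (by fun_prop)
  have hw9 : ∀ z : ℂ, 0 ≤ z.re → z.re ≤ 3 →
      Real.exp (z.re ^ 2 - (z.im - T) ^ 2) ≤ Real.exp 9 * Real.exp (-|z.im - T| ^ 2) := by
    intro z h0 h3
    rw [← Real.exp_add, Real.exp_le_exp, sq_abs]
    nlinarith
  have hgb : ∀ z : ℂ, 1 / 2 + δ ≤ z.re → z.re ≤ 3 → ‖g z‖ ≤ K * L := by
    intro z h1 h3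
    set d := |z.im - T| with hd
    have hd0 : 0 ≤ d := abs_nonneg _
    have hlog : Real.log (|z.im| + 7) ≤ L + d := by
      rw [hL, ← Real.log_exp d, ← Real.log_mul (by positivity) (by positivity)]
      refine Real.log_le_log (by positivity) ?_
      have hd1 := Real.add_one_le_exp d
      have : |z.im| ≤ d + |T| := by
        simpa using abs_add_le (z.im - T) T
      nlinarith
    have hde : (L + d) * Real.exp (-d ^ 2) ≤ 2 * L := by
      have h1 : d ≤ Real.exp (d ^ 2) := by nlinarith [Real.add_one_le_exp (d ^ 2), sq_nonneg (d - 1)]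
      have h2 : 1 ≤ Real.exp (d ^ 2) := Real.one_le_exp (by positivity)
      rw [Real.exp_neg, ← div_eq_mul_inv, div_le_iff₀ (Real.exp_pos _)]
      nlinarith
    rw [norm_mul, hw]
    calc ‖h z‖ * Real.exp (z.re ^ 2 - (z.im - T) ^ 2)
        ≤ (A * (L + d)) * (Real.exp 9 * Real.exp (-d ^ 2)) :=
          mul_le_mul ((hA z h1 h3).trans (mul_le_mul_of_nonneg_left hlog hA0.le))
            (hw9 z (by linarith) h3) (Real.exp_pos _).le (by positivity)
      _ = A * Real.exp 9 * ((L + d) * Real.exp (-d ^ 2)) := by ring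
      _ ≤ A * Real.exp 9 * (2 * L) := mul_le_mul_of_nonneg_left hde (by positivity)
      _ ≤ K * L := by
          rw [hK]
          have : 0 ≤ B * Real.exp 9 * L := by positivity
          nlinarith
  have hcl : closure (verticalStrip (1 / 2 + δ) 3) ⊆ {s : ℂ | 1 / 2 < s.re} := by
    refine (closure_minimal (t := {s : ℂ | 1 / 2 + δ ≤ s.re}) (fun z hz => le_of_lt hz.1)
      (isClosed_le continuous_const Complex.continuous_re)).trans fun z hz => ?_
    simp only [Set.mem_ofPred_eq] at hz ⊢
    linarith
  have key := norm_le_interp_of_mem_verticalClosedStrip' (f := g) (z := s) (a := K * L)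
    (b := K) (l := 1 / 2 + δ) (u := 3) (by linarith) ⟨by linarith, hs3⟩
    ((hgd.mono hcl).diffContOnCl) ⟨K * L, by
      rintro _ ⟨z, hz, rfl⟩
      exact hgb z hz.1 hz.2⟩ (fun z hz => hgb z (le_of_eq hz.symm) (by
        rw [show z.re = 1 / 2 + δ from hz]; linarith)) (fun z hz => by
        have hz3 : z.re = 3 := hz
        have hA9 : 0 < 2 * A * Real.exp 9 := by positivity
        rw [norm_mul, hw]
        refine (mul_le_mul (hB z (by linarith)) (b := B) (d := Real.exp 9) ?_
          (Real.exp_pos _).le hB0).trans (by rw [hK]; linarith)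
        rw [Real.exp_le_exp, hz3]
        nlinarith [sq_nonneg (z.im - T)])
  have hsg : ‖h s‖ ≤ ‖g s‖ := by
    rw [norm_mul, hw]
    refine le_mul_of_one_le_right (norm_nonneg _) (Real.one_le_exp ?_)
    rw [hT, sub_self]
    nlinarith [sq_nonneg s.re]
  refine hsg.trans (key.trans ?_)
  set τ := (s.re - (1 / 2 + δ)) / (3 - (1 / 2 + δ)) with hτ
  rw [Real.mul_rpow hK0.le (by linarith), mul_right_comm, ← Real.rpow_add hK0, sub_add_cancel,
    Real.rpow_one]
  refine mul_le_mul_of_nonneg_left (Real.rpow_le_rpow_of_exponent_le hL1 ?_) hK0.le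
  -- The point lies at least δ to the right of the left edge, and the strip has width at most 5/2.
  have : 2 * δ / 5 ≤ τ := by
    rw [hτ, le_div_iff₀ (by linarith)]
    nlinarith
  linarith

/-- Under the Riemann hypothesis `1 / ζ(s)` grows more slowly than any power of `|Im s|`, uniformly
to the right of any line `Re s = 1 / 2 + δ`. -/
theorem exists_norm_inv_riemannZeta₁_le (hRH : RiemannHypothesis) {δ ε : ℝ} (hδ : 0 < δ)
    (hε : 0 < ε) :
    ∃ C : ℝ, 0 < C ∧ ∀ s : ℂ, 1 / 2 + δ ≤ s.re →
      ‖(s - 1) / riemannZeta₁ s‖ ≤ C * (|s.im| + 7) ^ ε := by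
  obtain ⟨h, hd, he, B, hB0, hB⟩ := exists_log_riemannZeta₁_div hRH
  set δ' := min (δ / 2) 1 with hδ'
  have hδ'0 : 0 < δ' := lt_min (by linarith) one_pos
  have hδ'1 : 2 * δ' ≤ δ := by linarith [min_le_left (δ / 2) 1]
  obtain ⟨K, hK0, hK⟩ := exists_norm_log_le_mul_rpow hd he hB0 hB hδ'0 (min_le_right _ _)
  set η := 2 * δ' / 5 with hη
  have hη0 : 0 < η := by positivity
  obtain ⟨L₀, hL₀⟩ := eventually_atTop.mp
    ((tendsto_rpow_neg_atTop hη0).eventually (ge_mem_nhds (show 0 < ε / K by positivity)))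
  -- Past L₀ the sublinear power is at most εL; the constant covers smaller L. Exponentiating turns
  -- εL into (|t| + 7)^ε.
  have hbound : ∀ L : ℝ, 1 ≤ L → K * L ^ (1 - η) ≤ ε * L + K * |L₀| := by
    intro L hL
    have hL0 : 0 < L := by linarith
    by_cases hLL : L₀ ≤ L
    · rw [sub_eq_add_neg, Real.rpow_add hL0, Real.rpow_one]
      have h1 := mul_le_mul_of_nonneg_left (hL₀ L hLL) (show 0 ≤ K * L by positivity)
      have h2 : K * L * (ε / K) = ε * L := by field_simp
      have h3 : 0 ≤ K * |L₀| := by positivity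
      nlinarith
    · push Not at hLL
      have h1 : L ^ (1 - η) ≤ L := by
        conv_rhs => rw [← Real.rpow_one L]
        exact Real.rpow_le_rpow_of_exponent_le hL (by linarith)
      have h2 : L ≤ |L₀| := hLL.le.trans (le_abs_self _)
      have h3 := mul_le_mul_of_nonneg_left (h1.trans h2) hK0.le
      have h4 : 0 < ε * L := by positivity
      linarith
  refine ⟨Real.exp (K * |L₀|), Real.exp_pos _, fun s hs => ?_⟩
  have hre : 1 / 2 < s.re := by linarith
  have hs1 : ‖s - 1‖ ≤ ‖s + 1‖ := by
    rw [Complex.norm_def, Complex.norm_def]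
    refine Real.sqrt_le_sqrt ?_
    simp only [Complex.normSq_apply, Complex.sub_re, Complex.add_re, Complex.one_re,
      Complex.sub_im, Complex.add_im, Complex.one_im]
    nlinarith
  have hL1 : 1 ≤ Real.log (|s.im| + 7) := by
    rw [Real.le_log_iff_exp_le (by positivity)]
    linarith [Real.exp_one_lt_d9, abs_nonneg s.im]
  calc ‖(s - 1) / riemannZeta₁ s‖ ≤ ‖(s + 1) / riemannZeta₁ s‖ := by
        rw [norm_div, norm_div]
        gcongr
    _ = ‖Complex.exp (-h s)‖ := by rw [Complex.exp_neg, he s hre, inv_div]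
    _ ≤ Real.exp (ε * Real.log (|s.im| + 7) + K * |L₀|) := by
        refine (Complex.norm_exp_le_exp_norm _).trans (Real.exp_le_exp.mpr ?_)
        rw [norm_neg]
        exact (hK s (by linarith)).trans (hbound _ hL1)
    _ = Real.exp (K * |L₀|) * (|s.im| + 7) ^ ε := by
        rw [Real.exp_add, mul_comm, Real.rpow_def_of_pos (by positivity), mul_comm ε]

/-! ### An absolutely convergent Perron formula for the Mertens function. -/

theorem one_add_sq_le_norm_mul {s : ℂ} (hs : 1 / 2 ≤ s.re) :
    (1 + s.im ^ 2) ^ (1 / 2 : ℝ) / 2 ≤ ‖s‖ ∧ (1 + s.im ^ 2) ^ (1 / 2 : ℝ) ≤ ‖s + 1‖ := by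
  rw [← Real.sqrt_eq_rpow, Complex.norm_def, Complex.norm_def]
  constructor
  · rw [div_le_iff₀ two_pos, ← Real.sqrt_sq zero_le_two, ← Real.sqrt_mul (Complex.normSq_nonneg s),
      Complex.normSq_apply]
    exact Real.sqrt_le_sqrt (by nlinarith)
  · refine Real.sqrt_le_sqrt ?_
    simp only [Complex.normSq_apply, Complex.add_re, Complex.one_re, Complex.add_im,
      Complex.one_im]
    nlinarith

theorem norm_one_div_mul_add_one_le {s : ℂ} (hs : 1 / 2 ≤ s.re) :
    ‖1 / (s * (s + 1))‖ ≤ 2 * (1 + s.im ^ 2)⁻¹ := by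
  obtain ⟨h1, h2⟩ := one_add_sq_le_norm_mul hs
  have hpos : 0 < 1 + s.im ^ 2 := by positivity
  have h3 : (1 + s.im ^ 2) ^ (1 / 2 : ℝ) * (1 + s.im ^ 2) ^ (1 / 2 : ℝ) = 1 + s.im ^ 2 := by
    rw [← Real.rpow_add hpos]; norm_num
  have h4 := mul_le_mul h1 h2 (by positivity) (norm_nonneg s)
  rw [norm_div, norm_one, norm_mul, one_div, show 2 * (1 + s.im ^ 2)⁻¹ =
    ((1 + s.im ^ 2) / 2)⁻¹ by rw [inv_div, div_eq_mul_inv]]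
  exact inv_anti₀ (by positivity) (by linarith)

-- On (0, 1] the function is 1 - v, so its transform is 1/s - 1/(s + 1). Unlike the transform 1/s of
-- a sharp cutoff, it is absolutely integrable on vertical lines, which permits Mellin inversion.
open MeasureTheory Set in
theorem mellin_max_one_sub {s : ℂ} (hs : 0 < s.re) :
    HasMellin (fun v : ℝ => ((max (1 - v) 0 : ℝ) : ℂ)) s (1 / (s * (s + 1))) := by
  have h1 := hasMellin_one_Ioc hs
  have h2 := hasMellin_cpow_Ioc 1 (s := s) (by simp; linarith)
  have h := hasMellin_sub h1.1 h2.1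
  have heq : ∀ v ∈ Ioi (0 : ℝ), (indicator (Ioc 0 1) (fun _ => 1 : ℝ → ℂ) v -
      indicator (Ioc 0 1) (fun t => (t : ℂ) ^ (1 : ℂ) : ℝ → ℂ) v) =
      ((max (1 - v) 0 : ℝ) : ℂ) := fun v hv => by
    by_cases hv1 : v ≤ 1
    · have hm : v ∈ Ioc (0 : ℝ) 1 := ⟨hv, hv1⟩
      rw [indicator_of_mem hm, indicator_of_mem hm, Complex.cpow_one,
        max_eq_left (by linarith)]
      push_cast
      rfl
    · have hm : v ∉ Ioc (0 : ℝ) 1 := fun hm => hv1 hm.2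
      rw [indicator_of_notMem hm, indicator_of_notMem hm, max_eq_right (by linarith)]
      simp
  have hs0 : s ≠ 0 := by rintro rfl; simp at hs
  have hs1 : s + 1 ≠ 0 := fun h => by
    have := congrArg Complex.re h
    simp at this
    linarith
  rw [h1.2, h2.2] at h
  refine ⟨h.1.congr_fun (fun v hv => by simp only [heq v hv]) measurableSet_Ioi, ?_⟩
  have h3 := h.2
  rw [mellin, setIntegral_congr_fun measurableSet_Ioi
    (fun v hv => by simp only [heq v hv] : EqOn _
      (fun v : ℝ => (v : ℂ) ^ (s - 1) • ((max (1 - v) 0 : ℝ) : ℂ)) (Ioi 0))] at h3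
  rw [mellin, h3]
  field_simp
  ring

open MeasureTheory in
theorem integrable_one_add_sq_rpow {r : ℝ} (hr : 1 / 2 < r) :
    Integrable fun t : ℝ => (1 + t ^ 2) ^ (-r) := by
  have := integrable_rpow_neg_one_add_norm_sq (E := ℝ) (μ := volume) (r := 2 * r)
    (by simp; linarith)
  simpa [neg_div, mul_div_assoc] using this

open MeasureTheory in
theorem integrable_one_div_mul_add_one (σ : ℝ) (hσ : 1 / 2 ≤ σ) :
    Integrable fun t : ℝ => 1 / ((σ + t * Complex.I) * (σ + t * Complex.I + 1)) := by
  refine (integrable_inv_one_add_sq.const_mul 2).mono' ?_ (Eventually.of_forall fun t => ?_)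
  · refine Measurable.aestronglyMeasurable ?_
    fun_prop
  · simpa using norm_one_div_mul_add_one_le (s := σ + t * Complex.I) (by simpa using hσ)

theorem integral_perron {x : ℝ} (hx : 0 < x) :
    ∫ t : ℝ, (x : ℂ) ^ (-(((2 : ℝ) : ℂ) + t * Complex.I)) *
      (1 / ((((2 : ℝ) : ℂ) + t * Complex.I) * (((2 : ℝ) : ℂ) + t * Complex.I + 1))) =
      2 * Real.pi * ((max (1 - x) 0 : ℝ) : ℂ) := by
  have hm : ∀ t : ℝ, mellin (fun v : ℝ => ((max (1 - v) 0 : ℝ) : ℂ))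
      (((2 : ℝ) : ℂ) + t * Complex.I) =
      1 / ((((2 : ℝ) : ℂ) + t * Complex.I) * (((2 : ℝ) : ℂ) + t * Complex.I + 1)) := fun t =>
    (mellin_max_one_sub (by simp)).2
  have h := mellinInv_mellin_eq 2 (fun v : ℝ => ((max (1 - v) 0 : ℝ) : ℂ)) hx
    (mellin_max_one_sub (by simp)).1 ?_ (by fun_prop)
  · rw [← h, mellinInv]
    simp only [hm, smul_eq_mul]
    have h2 : (2 * Real.pi : ℂ) * ((1 / (2 * Real.pi) : ℝ) : ℂ) = 1 := by
      push_cast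
      field_simp [Real.pi_ne_zero]
    rw [Complex.real_smul, ← mul_assoc, h2, one_mul]
  · rw [Complex.VerticalIntegrable]
    simp only [hm]
    exact integrable_one_div_mul_add_one 2 (by norm_num)

/-- The kernel whose vertical integrals extract the Mertens function: the integral of `(s + 1) u ^ s`
over `N ≤ u ≤ N + 1`. -/
noncomputable def perronKernel (N : ℕ) (s : ℂ) : ℂ :=
  (((N : ℝ) + 1 : ℝ) : ℂ) ^ (s + 1) - ((N : ℝ) : ℂ) ^ (s + 1)

theorem norm_perronKernel_le {N : ℕ} (hN : 1 ≤ N) {s : ℂ} (hs : 0 ≤ s.re) :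
    ‖perronKernel N s‖ ≤ 2 * ((N : ℝ) + 1) ^ (s.re + 1) := by
  have hN0 : (0 : ℝ) < N := by exact_mod_cast hN
  refine (norm_sub_le _ _).trans ?_
  rw [Complex.norm_cpow_eq_rpow_re_of_pos hN0, Complex.norm_cpow_eq_rpow_re_of_pos (by positivity),
    Complex.add_re, Complex.one_re, two_mul]
  gcongr
  linarith

/-- The quotient is the integral of u^s over an interval of length one, so no extra power of N is
lost. -/
theorem norm_perronKernel_div_le {N : ℕ} (hN : 1 ≤ N) {s : ℂ} (hs : 0 ≤ s.re) :
    ‖perronKernel N s / (s + 1)‖ ≤ ((N : ℝ) + 1) ^ s.re := by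
  have hN0 : (0 : ℝ) < N := by exact_mod_cast hN
  rw [perronKernel, ← integral_cpow (Or.inl (by linarith))]
  refine (intervalIntegral.norm_integral_le_of_norm_le_const
    (C := ((N : ℝ) + 1) ^ s.re) fun u hu => ?_).trans_eq (by simp)
  rw [Set.uIoc_of_le (by linarith)] at hu
  have hu0 : 0 < u := hN0.trans hu.1
  rw [Complex.norm_cpow_eq_rpow_re_of_pos hu0]
  exact Real.rpow_le_rpow hu0.le hu.2 hs

theorem differentiable_perronKernel {N : ℕ} (hN : 1 ≤ N) : Differentiable ℂ (perronKernel N) := by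
  have h1 : (((N : ℝ) + 1 : ℝ) : ℂ) ≠ 0 := Complex.ofReal_ne_zero.mpr (by positivity)
  have h2 : ((N : ℝ) : ℂ) ≠ 0 := Complex.ofReal_ne_zero.mpr (by positivity)
  intro s
  exact ((differentiableAt_id.add_const 1).const_cpow (Or.inl h1)).sub
    ((differentiableAt_id.add_const 1).const_cpow (Or.inl h2))

open MeasureTheory in
theorem integral_perron_scaled {x X : ℝ} (hx : 0 < x) (hX : 0 < X) :
    Integrable (fun t : ℝ => (x : ℂ) ^ (-(((2 : ℝ) : ℂ) + t * Complex.I)) *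
      (X : ℂ) ^ (((2 : ℝ) : ℂ) + t * Complex.I + 1) *
      (1 / ((((2 : ℝ) : ℂ) + t * Complex.I) * (((2 : ℝ) : ℂ) + t * Complex.I + 1)))) ∧
    ∫ t : ℝ, (x : ℂ) ^ (-(((2 : ℝ) : ℂ) + t * Complex.I)) *
      (X : ℂ) ^ (((2 : ℝ) : ℂ) + t * Complex.I + 1) *
      (1 / ((((2 : ℝ) : ℂ) + t * Complex.I) * (((2 : ℝ) : ℂ) + t * Complex.I + 1))) =
      2 * Real.pi * ((max (X - x) 0 : ℝ) : ℂ) := by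
  have hX0 : (X : ℂ) ≠ 0 := Complex.ofReal_ne_zero.mpr hX.ne'
  have hx0 : (x : ℂ) ≠ 0 := Complex.ofReal_ne_zero.mpr hx.ne'
  constructor
  · refine (integrable_one_div_mul_add_one 2 (by norm_num)).bdd_mul (c := x ^ (-2 : ℝ) * X ^ (3 : ℝ))
      ?_ (Eventually.of_forall fun t => ?_)
    · refine (Measurable.aestronglyMeasurable ?_)
      fun_prop
    · rw [norm_mul, Complex.norm_cpow_eq_rpow_re_of_pos hx, Complex.norm_cpow_eq_rpow_re_of_pos hX]
      simp
      norm_num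
  · have hscale : ∀ s : ℂ, (x : ℂ) ^ (-s) * (X : ℂ) ^ (s + 1) = X * ((x / X : ℝ) : ℂ) ^ (-s) := by
      intro s
      have h1 : (x : ℂ) = ((x / X : ℝ) : ℂ) * (X : ℂ) := by
        rw [← Complex.ofReal_mul, div_mul_cancel₀ _ hX.ne']
      conv_lhs => rw [h1]
      rw [Complex.mul_cpow_ofReal_nonneg (by positivity) hX.le, mul_assoc,
        ← Complex.cpow_add _ _ hX0, neg_add_cancel_left, Complex.cpow_one, mul_comm]
    simp only [hscale, mul_assoc]
    rw [integral_const_mul, integral_perron (div_pos hx hX)]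
    have h2 : max (X - x) 0 = X * max (1 - x / X) 0 := by
      rw [mul_max_of_nonneg _ _ hX.le, mul_zero, mul_sub, mul_one, mul_div_cancel₀ _ hX.ne']
    rw [h2]
    push_cast
    ring

-- The difference max(N + 1 - n, 0) - max(N - n, 0) is exactly the indicator of n ≤ N: differencing
-- at consecutive integers undoes the smoothing.
open MeasureTheory in
theorem integral_cpow_mul_perronKernel {n N : ℕ} (hn : 1 ≤ n) (hN : 1 ≤ N) :
    ∫ t : ℝ, (n : ℂ) ^ (-(((2 : ℝ) : ℂ) + t * Complex.I)) *
      perronKernel N (((2 : ℝ) : ℂ) + t * Complex.I) *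
      (1 / ((((2 : ℝ) : ℂ) + t * Complex.I) * (((2 : ℝ) : ℂ) + t * Complex.I + 1))) =
      2 * Real.pi * if n ≤ N then 1 else 0 := by
  have h1 := integral_perron_scaled (x := n) (X := (N : ℝ) + 1) (by positivity) (by positivity)
  have h2 := integral_perron_scaled (x := n) (X := N) (by positivity) (by positivity)
  have h3 := integral_sub h1.1 h2.1
  rw [h1.2, h2.2] at h3
  simp only [perronKernel, mul_sub, sub_mul]
  simp only [Complex.ofReal_natCast] at h3 ⊢
  rw [h3, ← mul_sub, ← Complex.ofReal_sub]
  congr 1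
  split_ifs with h
  · have h' : (n : ℝ) ≤ N := by exact_mod_cast h
    rw [max_eq_left (by linarith), max_eq_left (by linarith)]
    norm_num
  · have h' : (N : ℝ) + 1 ≤ n := by exact_mod_cast (by omega : N + 1 ≤ n)
    rw [max_eq_right (by linarith), max_eq_right (by linarith)]
    norm_num

/-- The integrand of the Perron formula for the Mertens function. -/
noncomputable def perronIntegrand (N : ℕ) (s : ℂ) : ℂ :=
  (s - 1) / riemannZeta₁ s * perronKernel N s * (1 / (s * (s + 1)))

-- Expand 1/ζ as the Dirichlet series of μ and integrate termwise. On Re s = 2 the moduli of its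
-- terms do not depend on t, which justifies the interchange.
open MeasureTheory in
theorem integral_perronIntegrand {N : ℕ} (hN : 1 ≤ N) :
    ∫ t : ℝ, perronIntegrand N (((2 : ℝ) : ℂ) + t * Complex.I) = 2 * Real.pi * (mertens N : ℂ) := by
  let μ : ℕ → ℂ := fun n => ((ArithmeticFunction.moebius n : ℤ) : ℂ)
  let s : ℝ → ℂ := fun t => ((2 : ℝ) : ℂ) + t * Complex.I
  let w : ℝ → ℂ := fun t => perronKernel N (s t) * (1 / (s t * (s t + 1)))
  have hsre : ∀ t, (s t).re = 2 := fun t => by simp [s]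
  have hw : Integrable w := by
    refine (integrable_one_div_mul_add_one 2 (by norm_num)).bdd_mul
      (c := 2 * ((N : ℝ) + 1) ^ (3 : ℝ)) ?_ (Eventually.of_forall fun t => ?_)
    · have := (differentiable_perronKernel hN).continuous.measurable
      exact Measurable.aestronglyMeasurable (by fun_prop)
    · refine (norm_perronKernel_le hN (s := s t) (by rw [hsre]; norm_num)).trans_eq ?_
      rw [hsre, show (2 : ℝ) + 1 = 3 by norm_num]
  let F : ℕ → ℝ → ℂ := fun n t => LSeries.term μ (s t) n * w t
  have hterm : ∀ n t, ‖LSeries.term μ (s t) n‖ = ‖LSeries.term μ 2 n‖ := fun n t => by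
    rw [LSeries.norm_term_eq, LSeries.norm_term_eq, hsre]
    rfl
  have hFi : ∀ n, Integrable (F n) := fun n => by
    refine hw.bdd_mul (c := ‖LSeries.term μ 2 n‖) ?_ (Eventually.of_forall fun t => (hterm n t).le)
    refine Measurable.aestronglyMeasurable ?_
    rcases eq_or_ne n 0 with rfl | hn
    · simp
    · simp only [LSeries.term_of_ne_zero hn, s]
      fun_prop
  have hsum2 : LSeriesSummable μ 2 :=
    ArithmeticFunction.LSeriesSummable_moebius_iff.mpr (by norm_num)
  have hFs : Summable fun n => ∫ t, ‖F n t‖ := by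
    have : ∀ n, ∫ t, ‖F n t‖ = ‖LSeries.term μ 2 n‖ * ∫ t, ‖w t‖ := fun n => by
      simp only [F, norm_mul, hterm, integral_const_mul]
    simp only [this]
    exact hsum2.norm.mul_right _
  have h1 := hasSum_integral_of_summable_integral_norm hFi hFs
  have h2 : ∀ t, ∑' n, F n t = perronIntegrand N (s t) := fun t => by
    have hs1 : 1 < (s t).re := by rw [hsre]; norm_num
    have hne : s t ≠ 1 := fun h => by simp [h] at hs1
    have hL := ArithmeticFunction.LSeries_zeta_mul_Lseries_moebius hs1
    rw [ArithmeticFunction.LSeries_zeta_eq_riemannZeta hs1, riemannZeta_eq_inv_sub_mul hne] at hL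
    have hz : riemannZeta₁ (s t) ≠ 0 := fun h => by simp [h] at hL
    have hne' : s t - 1 ≠ 0 := sub_ne_zero.mpr hne
    have hL' : LSeries μ (s t) = (s t - 1) / riemannZeta₁ (s t) := by
      rw [eq_div_iff hz]
      field_simp at hL
      rw [← hL]
      exact mul_comm _ _
    rw [tsum_mul_right, perronIntegrand, mul_assoc, ← hL']
    rfl
  simp only [h2] at h1
  have h3 : ∀ n, ∫ t, F n t = 2 * Real.pi * if n ∈ Finset.Icc 1 N then μ n else 0 := fun n => by
    rcases Nat.eq_zero_or_pos n with rfl | hn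
    · simp [F]
    · have : ∀ t, F n t = μ n * ((n : ℂ) ^ (-s t) * perronKernel N (s t) *
          (1 / (s t * (s t + 1)))) := fun t => by
        simp only [F, w, LSeries.term_of_ne_zero hn.ne', Complex.cpow_neg]
        ring
      simp only [this]
      rw [integral_const_mul, integral_cpow_mul_perronKernel hn hN]
      have : n ∈ Finset.Icc 1 N ↔ n ≤ N := by simp; omega
      simp only [this]
      split_ifs <;> ring
  simp only [h3] at h1
  have h4 := hasSum_sum_of_ne_finset_zero (L := SummationFilter.unconditional ℕ)
    (f := fun n => 2 * (Real.pi : ℂ) * if n ∈ Finset.Icc 1 N then μ n else 0)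
    (s := Finset.Icc 1 N) (fun n hn => by simp only [if_neg hn, mul_zero])
  rw [h1.unique h4, ← Finset.mul_sum, Finset.sum_ite_mem, Finset.inter_self, mertens]
  push_cast
  rfl

/-! ### Shifting the line of integration, and the Mertens bound under RH. -/

open MeasureTheory in
/-- The integral of a holomorphic function over a vertical line does not change under a shift of
the line through a strip in which the function decays. -/
theorem integral_vertical_eq_of_norm_le {G : ℂ → ℂ} {a b D r : ℝ} (hab : a ≤ b) (hr : 1 / 2 < r)
    (hG : ∀ s : ℂ, a ≤ s.re → s.re ≤ b → DifferentiableAt ℂ G s)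
    (hb : ∀ s : ℂ, a ≤ s.re → s.re ≤ b → ‖G s‖ ≤ D * (1 + s.im ^ 2) ^ (-r)) :
    ∫ t : ℝ, G (a + t * Complex.I) = ∫ t : ℝ, G (b + t * Complex.I) := by
  have hint : ∀ σ : ℝ, a ≤ σ → σ ≤ b → Integrable fun t : ℝ => G (σ + t * Complex.I) := by
    intro σ h1 h2
    refine ((integrable_one_add_sq_rpow hr).const_mul D).mono' ?_ (Eventually.of_forall fun t => ?_)
    · refine Continuous.aestronglyMeasurable (continuous_iff_continuousAt.mpr fun t => ?_)
      have hline : Continuous fun t : ℝ => (σ + t * Complex.I : ℂ) := by fun_prop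
      exact ContinuousAt.comp (f := fun t : ℝ => (σ + t * Complex.I : ℂ))
        (hG (σ + t * Complex.I) (by simpa using h1) (by simpa using h2)).continuousAt
        hline.continuousAt
    · simpa using hb (σ + t * Complex.I) (by simpa using h1) (by simpa using h2)
  have hlim : ∀ σ : ℝ, a ≤ σ → σ ≤ b → Tendsto (fun T : ℝ => ∫ t in (-T)..T,
      G (σ + t * Complex.I)) atTop (nhds (∫ t : ℝ, G (σ + t * Complex.I))) := fun σ h1 h2 =>
    intervalIntegral_tendsto_integral (hint σ h1 h2) tendsto_neg_atTop_atBot tendsto_id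
  have hhor : ∀ T : ℝ, ‖∫ x in a..b, G (x + T * Complex.I)‖ ≤
      D * (1 + T ^ 2) ^ (-r) * (b - a) := by
    intro T
    refine (intervalIntegral.norm_integral_le_of_norm_le_const
      (C := D * (1 + T ^ 2) ^ (-r)) fun x hx => ?_).trans_eq (by
        rw [abs_of_nonneg (sub_nonneg.mpr hab)])
    rw [Set.uIoc_of_le hab] at hx
    simpa using hb (x + T * Complex.I) (by simpa using hx.1.le) (by simpa using hx.2)
  have hdecay : Tendsto (fun T : ℝ => D * (1 + T ^ 2) ^ (-r) * (b - a)) atTop (nhds 0) := by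
    have h1 : Tendsto (fun T : ℝ => 1 + T ^ 2) atTop atTop :=
      tendsto_atTop_add_const_left _ _ (tendsto_pow_atTop two_ne_zero)
    have h2 := (tendsto_rpow_neg_atTop (show 0 < r by linarith)).comp h1
    simpa using (h2.const_mul D).mul_const (b - a)
  have htop : Tendsto (fun T : ℝ => ∫ x in a..b, G (x + T * Complex.I)) atTop (nhds 0) :=
    squeeze_zero_norm hhor hdecay
  have hbot : Tendsto (fun T : ℝ => ∫ x in a..b, G (x + (-T : ℝ) * Complex.I)) atTop (nhds 0) :=
    squeeze_zero_norm (fun T => by simpa using hhor (-T)) hdecay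
  have hrect : ∀ T : ℝ, (∫ x in a..b, G (x + (-T : ℝ) * Complex.I)) -
      (∫ x in a..b, G (x + T * Complex.I)) +
      Complex.I * (∫ t in (-T)..T, G (b + t * Complex.I)) -
      Complex.I * (∫ t in (-T)..T, G (a + t * Complex.I)) = 0 := by
    intro T
    have := Complex.integral_boundary_rect_eq_zero_of_differentiableOn G ⟨a, -T⟩ ⟨b, T⟩
      (fun s hs => by
        have h1 : s.re ∈ Set.uIcc a b := hs.1
        rw [Set.uIcc_of_le hab] at h1
        exact (hG s h1.1 h1.2).differentiableWithinAt)
    simpa using this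
  have hL := ((hbot.sub htop).add ((hlim b hab le_rfl).const_mul Complex.I)).sub
    ((hlim a le_rfl hab).const_mul Complex.I)
  have h0 := tendsto_nhds_unique (hL.congr hrect) tendsto_const_nhds
  rw [sub_zero, zero_add, ← mul_sub, mul_eq_zero, sub_eq_zero] at h0
  exact (h0.resolve_left Complex.I_ne_zero).symm

theorem exists_norm_inv_riemannZeta₁_le' (hRH : RiemannHypothesis) {δ ε : ℝ} (hδ : 0 < δ)
    (hε : 0 < ε) :
    ∃ C : ℝ, 0 < C ∧ ∀ s : ℂ, 1 / 2 + δ ≤ s.re →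
      ‖(s - 1) / riemannZeta₁ s‖ ≤ C * (1 + s.im ^ 2) ^ ε := by
  obtain ⟨C, hC, h⟩ := exists_norm_inv_riemannZeta₁_le hRH hδ hε
  refine ⟨C * 8 ^ ε, by positivity, fun s hs => (h s hs).trans ?_⟩
  rw [mul_assoc, ← Real.mul_rpow (by norm_num) (by positivity)]
  gcongr
  nlinarith [sq_abs s.im, sq_nonneg (|s.im| - 1), abs_nonneg s.im]

theorem integral_perronIntegrand_shift (hRH : RiemannHypothesis) {N : ℕ} (hN : 1 ≤ N) {a : ℝ}
    (ha : 1 / 2 < a) (ha2 : a ≤ 2) :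
    ∫ t : ℝ, perronIntegrand N (a + t * Complex.I) = 2 * Real.pi * (mertens N : ℂ) := by
  -- With exponent 1/4 the integrand is O((1 + t²)^(-3/4)), and 3/4 > 1/2. The dependence on N is
  -- irrelevant for the shift.
  obtain ⟨C, hC, h⟩ := exists_norm_inv_riemannZeta₁_le' hRH (sub_pos.mpr ha)
    (show (0 : ℝ) < 1 / 4 by norm_num)
  have hN1 : (1 : ℝ) ≤ (N : ℝ) + 1 := by linarith [N.cast_nonneg (α := ℝ)]
  rw [← integral_perronIntegrand hN]
  refine integral_vertical_eq_of_norm_le (r := 3 / 4) (D := C * (2 * ((N : ℝ) + 1) ^ (3 : ℝ)) * 2)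
    ha2 (by norm_num) (fun s h1 _ => ?_) (fun s h1 h2 => ?_)
  · have hz : riemannZeta₁ s ≠ 0 := riemannZeta₁_ne_zero hRH (by linarith)
    have hs0 : s ≠ 0 := by
      rintro rfl
      rw [Complex.zero_re] at h1
      linarith
    have hs1 : s + 1 ≠ 0 := fun h => by
      have := congrArg Complex.re h
      simp at this
      linarith
    have hk : DifferentiableAt ℂ (perronKernel N) s := differentiable_perronKernel hN s
    have hζ : DifferentiableAt ℂ riemannZeta₁ s := differentiable_riemannZeta₁ s
    have hq : DifferentiableAt ℂ (fun s : ℂ => 1 / (s * (s + 1))) s := by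
      fun_prop (disch := exact mul_ne_zero hs0 hs1)
    exact (((differentiableAt_id.sub_const 1).div hζ hz).mul hk).mul hq
  · have hpos : 0 < 1 + s.im ^ 2 := by positivity
    have e1 := h s (by linarith)
    have e2 : ‖perronKernel N s‖ ≤ 2 * ((N : ℝ) + 1) ^ (3 : ℝ) := by
      refine (norm_perronKernel_le hN (by linarith)).trans ?_
      gcongr
      linarith
    have e3 := norm_one_div_mul_add_one_le (s := s) (by linarith)
    rw [perronIntegrand, norm_mul, norm_mul]
    refine (mul_le_mul (mul_le_mul e1 e2 (norm_nonneg _) (by positivity)) e3 (norm_nonneg _)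
      (by positivity)).trans_eq ?_
    rw [show (-(3 / 4) : ℝ) = 1 / 4 + -1 by norm_num, Real.rpow_add hpos, Real.rpow_neg_one]
    ring

/-- A weighted geometric mean of the bounds X^σ, without decay, and 2 X^(σ+1) / |s + 1|: a factor
X^η buys decay of order |t|^(-η). -/
theorem norm_perronKernel_div_le_interp {N : ℕ} (hN : 1 ≤ N) {s : ℂ} (hs : 1 / 2 ≤ s.re) {η : ℝ}
    (hη0 : 0 ≤ η) (hη1 : η ≤ 1) :
    ‖perronKernel N s / (s + 1)‖ ≤
      2 * ((N : ℝ) + 1) ^ (s.re + η) * (1 + s.im ^ 2) ^ (-(η / 2)) := by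
  have hpos : 0 < 1 + s.im ^ 2 := by positivity
  have hN0 : (0 : ℝ) < (N : ℝ) + 1 := by positivity
  set X := (N : ℝ) + 1 with hX
  set x := ‖perronKernel N s / (s + 1)‖ with hx
  have hx0 : 0 ≤ x := norm_nonneg _
  have h1 : x ≤ X ^ s.re := norm_perronKernel_div_le hN (by linarith)
  have h2 : x ≤ 2 * X ^ (s.re + 1) * (1 + s.im ^ 2) ^ (-(1 / 2) : ℝ) := by
    rw [hx, norm_div, Real.rpow_neg hpos.le, ← div_eq_mul_inv]
    exact div_le_div₀ (by positivity) (norm_perronKernel_le hN (by linarith)) (by positivity)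
      (one_add_sq_le_norm_mul hs).2
  calc x = x ^ (1 - η) * x ^ η := by
        rw [← Real.rpow_add' hx0 (by norm_num), sub_add_cancel, Real.rpow_one]
    _ ≤ (X ^ s.re) ^ (1 - η) * (2 * X ^ (s.re + 1) * (1 + s.im ^ 2) ^ (-(1 / 2) : ℝ)) ^ η := by
        have : 0 ≤ 1 - η := by linarith
        gcongr
    _ = 2 ^ η * X ^ (s.re + η) * (1 + s.im ^ 2) ^ (-(η / 2)) := by
        rw [Real.mul_rpow (by positivity) (by positivity), Real.mul_rpow (by positivity)
          (by positivity), ← Real.rpow_mul hN0.le, ← Real.rpow_mul hN0.le, ← Real.rpow_mul hpos.le,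
          show s.re + η = s.re * (1 - η) + (s.re + 1) * η by ring, Real.rpow_add hN0,
          show -(1 / 2) * η = -(η / 2) by ring]
        ring
    _ ≤ 2 * X ^ (s.re + η) * (1 + s.im ^ 2) ^ (-(η / 2)) := by
        gcongr
        calc (2 : ℝ) ^ η ≤ 2 ^ (1 : ℝ) := Real.rpow_le_rpow_of_exponent_le (by norm_num) hη1
          _ = 2 := Real.rpow_one 2

open MeasureTheory in
theorem mertens_le_of_riemannHypothesis (hRH : RiemannHypothesis) {ε : ℝ} (hε : 0 < ε)
    (hε1 : ε ≤ 1 / 4) :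
    ∃ C : ℝ, 0 ≤ C ∧ ∀ N : ℕ, 1 ≤ N →
      |(mertens N : ℝ)| ≤ C * ((N : ℝ) + 1) ^ (1 / 2 + 5 * ε) := by
  obtain ⟨C, hC, h⟩ := exists_norm_inv_riemannZeta₁_le' hRH hε hε
  set I := ∫ t : ℝ, (1 + t ^ 2) ^ (-(1 / 2 + ε)) with hI
  have hI0 : 0 ≤ I := integral_nonneg fun t => by positivity
  refine ⟨4 * C * I, by positivity, fun N hN => ?_⟩
  have hshift := integral_perronIntegrand_shift hRH hN (a := 1 / 2 + ε) (by linarith) (by linarith)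
  have hbound : ∀ t : ℝ, ‖perronIntegrand N (((1 / 2 + ε : ℝ) : ℂ) + t * Complex.I)‖ ≤
      4 * C * ((N : ℝ) + 1) ^ (1 / 2 + 5 * ε) * (1 + t ^ 2) ^ (-(1 / 2 + ε)) := by
    intro t
    set s : ℂ := ((1 / 2 + ε : ℝ) : ℂ) + t * Complex.I with hs
    have hre : s.re = 1 / 2 + ε := by simp [hs]
    have him : s.im = t := by simp [hs]
    have hpos : 0 < 1 + t ^ 2 := by positivity
    have e1 := h s hre.ge
    -- With η = 4ε the powers of 1 + t² are ε from 1/ζ, -2ε from the kernel and -1/2 from 1/s,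
    -- totalling -(1/2 + ε), which is integrable; N + 1 gets exponent 1/2 + 5ε.
    have e2 := norm_perronKernel_div_le_interp hN (s := s) (η := 4 * ε) (by linarith)
      (by linarith) (by linarith)
    have e3 := (one_add_sq_le_norm_mul (s := s) (by linarith)).1
    rw [him] at e1 e2 e3
    have e4 : ‖1 / s‖ ≤ 2 * (1 + t ^ 2) ^ (-(1 / 2) : ℝ) := by
      rw [norm_div, norm_one, one_div, Real.rpow_neg hpos.le, ← div_eq_mul_inv, ← inv_div]
      exact inv_anti₀ (by positivity) e3
    have e5 : perronIntegrand N s =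
        (s - 1) / riemannZeta₁ s * (perronKernel N s / (s + 1)) * (1 / s) := by
      rw [perronIntegrand]
      simp only [mul_inv, div_eq_mul_inv]
      ring
    rw [e5, norm_mul, norm_mul]
    refine (mul_le_mul (mul_le_mul e1 e2 (norm_nonneg _) (by positivity)) e4 (norm_nonneg _)
      (by positivity)).trans_eq ?_
    rw [hre, show -(1 / 2 + ε) = ε + (-(4 * ε / 2) + -(1 / 2)) by ring, Real.rpow_add hpos,
      Real.rpow_add hpos, show 1 / 2 + ε + 4 * ε = 1 / 2 + 5 * ε by ring]
    ring
  have hnorm : 2 * Real.pi * |(mertens N : ℝ)| ≤ 4 * C * I * ((N : ℝ) + 1) ^ (1 / 2 + 5 * ε) := by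
    have h1 := norm_integral_le_of_norm_le
      ((integrable_one_add_sq_rpow (show 1 / 2 < 1 / 2 + ε by linarith)).const_mul
        (4 * C * ((N : ℝ) + 1) ^ (1 / 2 + 5 * ε))) (Eventually.of_forall hbound)
    rw [hshift, integral_const_mul, ← hI, norm_mul, norm_mul, Complex.norm_intCast,
      Complex.norm_ofNat, Complex.norm_real, Real.norm_of_nonneg Real.pi_pos.le] at h1
    linarith
  have hπ : 1 * |(mertens N : ℝ)| ≤ 2 * Real.pi * |(mertens N : ℝ)| :=
    mul_le_mul_of_nonneg_right (by linarith [Real.pi_gt_three]) (abs_nonneg _)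
  linarith

theorem riemannHypothesis_iff_mertens_le :
    RiemannHypothesis ↔ ∀ ε : ℝ, 0 < ε → ∃ C : ℝ, 0 ≤ C ∧ ∀ N : ℕ, 1 ≤ N →
      |(mertens N : ℝ)| ≤ C * (N : ℝ) ^ (1 / 2 + ε) := by
  constructor
  · intro hRH ε hε
    obtain ⟨C, hC, h⟩ := mertens_le_of_riemannHypothesis hRH (ε := min (ε / 5) (1 / 4))
      (lt_min (by positivity) (by norm_num)) (min_le_right _ _)
    refine ⟨C * 2 ^ (1 / 2 + ε), by positivity, fun N hN => (h N hN).trans ?_⟩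
    have hN1 : (1 : ℝ) ≤ N := by exact_mod_cast hN
    rw [mul_assoc, ← Real.mul_rpow zero_le_two (by positivity)]
    refine mul_le_mul_of_nonneg_left ?_ hC
    calc ((N : ℝ) + 1) ^ (1 / 2 + 5 * min (ε / 5) (1 / 4))
        ≤ ((N : ℝ) + 1) ^ (1 / 2 + ε) := Real.rpow_le_rpow_of_exponent_le (by linarith)
          (by linarith [min_le_left (ε / 5) (1 / 4)])
      _ ≤ (2 * (N : ℝ)) ^ (1 / 2 + ε) :=
          Real.rpow_le_rpow (by positivity) (by linarith) (by positivity)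
  · intro h
    refine riemannHypothesis_of_ne_zero fun s hs hs1 => ?_
    -- Half the distance to the critical line keeps the exponent strictly below Re s.
    obtain ⟨C, _, hC⟩ := h ((s.re - 1 / 2) / 2) (by linarith)
    exact riemannZeta_ne_zero_of_mertens_le (by linarith) hC (by linarith) hs1

/-! ### Transfer between the Mertens bound and the growth conditions on χ. -/

theorem isBigO_eulerCharacteristic_of_mertens_le {C p : ℝ} (hC : 0 ≤ C) (hp : 0 ≤ p)
    (h : ∀ N : ℕ, 1 ≤ N → |(mertens N : ℝ)| ≤ C * (N : ℝ) ^ p) :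
    (fun q : ℝ => |(eulerCharacteristic (logPrime q) : ℝ)|)
      =O[atTop] fun q : ℝ => Real.exp (q * p) := by
  refine IsBigO.of_bound (1 + C) ?_
  filter_upwards [eventually_ge_atTop (1 : ℝ)] with q hq
  have hexp : 2 ≤ Real.exp q := by linarith [Real.add_one_le_exp q]
  obtain ⟨N, hN⟩ : ∃ N, ⌈Real.exp q⌉₊ = N + 1 :=
    ⟨⌈Real.exp q⌉₊ - 1, by have := Nat.ceil_pos.mpr (Real.exp_pos q); omega⟩
  have hle : Real.exp q ≤ (N : ℝ) + 1 := by
    have := Nat.le_ceil (Real.exp q)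
    rw [hN] at this
    exact_mod_cast this
  have hlt : (N : ℝ) < Real.exp q := by
    have := Nat.ceil_lt_add_one (Real.exp_pos q).le
    rw [hN] at this
    push_cast at this
    linarith
  have hN1 : 1 ≤ N := by
    have : (1 : ℝ) ≤ N := by linarith
    exact_mod_cast this
  rw [(eulerCharacteristic_logPrime_eq_mertens q hN1 hN).2, Real.norm_eq_abs, abs_abs,
    Real.norm_of_nonneg (Real.exp_pos _).le, Real.exp_mul]
  push_cast
  have h1 : (N : ℝ) ^ p ≤ Real.exp q ^ p := Real.rpow_le_rpow (by positivity) hlt.le hp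
  have h2 : 1 ≤ Real.exp q ^ p := Real.one_le_rpow (by linarith) hp
  have h3 : |(1 : ℝ) - mertens N| ≤ 1 + |(mertens N : ℝ)| := by
    simpa using abs_sub (1 : ℝ) (mertens N)
  have h4 := (h N hN1).trans (mul_le_mul_of_nonneg_left h1 hC)
  linarith

theorem log_eulerCharacteristic_le_of_isBigO {p : ℝ}
    (h : (fun q : ℝ => |(eulerCharacteristic (logPrime q) : ℝ)|)
      =O[atTop] fun q : ℝ => Real.exp (q * p)) :
    ∃ C : ℝ, 0 < C ∧ ∀ᶠ q : ℝ in atTop, eulerCharacteristic (logPrime q) ≠ 0 →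
      Real.log |(eulerCharacteristic (logPrime q) : ℝ)| ≤ p * q + Real.log C := by
  obtain ⟨C, hC, hb⟩ := h.exists_pos
  refine ⟨C, hC, hb.bound.mono fun q hq h0 => ?_⟩
  rw [Real.norm_eq_abs, abs_abs, Real.norm_of_nonneg (Real.exp_pos _).le] at hq
  have hpos : 0 < |(eulerCharacteristic (logPrime q) : ℝ)| :=
    abs_pos.mpr (Int.cast_ne_zero.mpr h0)
  refine (Real.log_le_log hpos hq).trans_eq ?_
  rw [Real.log_mul hC.ne' (Real.exp_pos _).ne', Real.log_exp]
  ring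

theorem isBigO_eulerCharacteristic_log_of_log_le {p C : ℝ} (hp : 0 ≤ p) (hC : 0 < C)
    (h : ∀ᶠ q : ℝ in atTop, eulerCharacteristic (logPrime q) ≠ 0 →
      Real.log |(eulerCharacteristic (logPrime q) : ℝ)| ≤ p * q + Real.log C) :
    (fun N : ℕ => |(eulerCharacteristic (logPrime (Real.log ((N : ℝ) + 1))) : ℝ)|)
      =O[atTop] fun N : ℕ => (N : ℝ) ^ p := by
  have htend : Tendsto (fun N : ℕ => Real.log ((N : ℝ) + 1)) atTop atTop :=
    Real.tendsto_log_atTop.comp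
      (tendsto_atTop_add_const_right _ _ tendsto_natCast_atTop_atTop)
  refine IsBigO.of_bound (C * 2 ^ p) ?_
  filter_upwards [htend.eventually h, eventually_ge_atTop 1] with N hN hN1
  have hN1' : (1 : ℝ) ≤ N := by exact_mod_cast hN1
  rw [Real.norm_eq_abs, abs_abs, Real.norm_of_nonneg (by positivity), mul_assoc,
    ← Real.mul_rpow zero_le_two (by positivity)]
  by_cases h0 : eulerCharacteristic (logPrime (Real.log ((N : ℝ) + 1))) = 0
  · rw [h0, Int.cast_zero, abs_zero]
    positivity
  · have hpos : 0 < |(eulerCharacteristic (logPrime (Real.log ((N : ℝ) + 1))) : ℝ)| :=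
      abs_pos.mpr (Int.cast_ne_zero.mpr h0)
    have h1 := (Real.log_le_iff_le_exp hpos).mp (hN h0)
    rw [Real.exp_add, Real.exp_log hC, mul_comm p, Real.exp_mul, Real.exp_log (by positivity),
      mul_comm] at h1
    refine h1.trans (mul_le_mul_of_nonneg_left ?_ hC.le)
    exact Real.rpow_le_rpow (by positivity) (by linarith) hp

theorem mertens_le_of_isBigO_eulerCharacteristic {p : ℝ} (hp : 0 ≤ p)
    (h : (fun N : ℕ => |(eulerCharacteristic (logPrime (Real.log ((N : ℝ) + 1))) : ℝ)|)
      =O[atTop] fun N : ℕ => (N : ℝ) ^ p) :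
    ∃ C : ℝ, 0 ≤ C ∧ ∀ N : ℕ, 1 ≤ N → |(mertens N : ℝ)| ≤ C * (N : ℝ) ^ p := by
  -- On ℕ an eventual bound becomes one for all N with N^p ≠ 0, after enlarging the constant.
  obtain ⟨C, hC, hb⟩ := bound_of_isBigO_nat_atTop h
  refine ⟨1 + C, by positivity, fun N hN => ?_⟩
  have hN1 : (1 : ℝ) ≤ N := by exact_mod_cast hN
  have h1 := hb (x := N) (by positivity)
  rw [(eulerCharacteristic_logPrime_eq_mertens _ hN (ceil_exp_log_natCast_add_one N)).2,
    Real.norm_eq_abs, abs_abs, Real.norm_of_nonneg (by positivity)] at h1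
  push_cast at h1
  have h2 : |(mertens N : ℝ)| ≤ 1 + |(1 : ℝ) - mertens N| := by
    simpa using abs_sub (1 : ℝ) (1 - mertens N)
  have h3 : 1 ≤ (N : ℝ) ^ p := Real.one_le_rpow hN1 hp
  linarith

theorem mainTheorem3 :
    -- the Euler characteristic of the (finite) complex `LogPrime(q)`
    (∀ q : ℝ, 0 < q →
      (logPrime q).faces.Finite ∧
      eulerCharacteristic (logPrime q) =
        -∑ n ∈ integersFromTwoBelow (Real.exp q), ArithmeticFunction.moebius n) ∧
    -- the special case `q = ln (N + 1)`
    (∀ N : ℕ, 1 ≤ N →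
      eulerCharacteristic (logPrime (Real.log ((N : ℝ) + 1))) =
        -∑ n ∈ Finset.Icc 2 N, ArithmeticFunction.moebius n ∧
      eulerCharacteristic (logPrime (Real.log ((N : ℝ) + 1))) = 1 - mertens N) ∧
    -- the Riemann hypothesis as a growth condition along `q = ln (N + 1)`, in terms of `N`
    (RiemannHypothesis ↔ ∀ ε : ℝ, 0 < ε →
      (fun N : ℕ => |(eulerCharacteristic (logPrime (Real.log ((N : ℝ) + 1))) : ℝ)|)
        =O[atTop] fun N : ℕ => (N : ℝ) ^ (1 / 2 + ε : ℝ)) ∧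
    -- the Riemann hypothesis as a growth condition in the real variable `q`
    (RiemannHypothesis ↔ ∀ ε : ℝ, 0 < ε →
      (fun q : ℝ => |(eulerCharacteristic (logPrime q) : ℝ)|)
        =O[atTop] fun q : ℝ => Real.exp (q * (1 / 2 + ε))) ∧
    -- its logarithmic form, where a vanishing Euler characteristic imposes no condition
    (RiemannHypothesis ↔ ∀ ε : ℝ, 0 < ε → ∃ C : ℝ, 0 < C ∧ ∀ᶠ q : ℝ in atTop,
      eulerCharacteristic (logPrime q) ≠ 0 →
        Real.log |(eulerCharacteristic (logPrime q) : ℝ)| ≤ (1 / 2 + ε) * q + Real.log C) := by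
  have h12 : ∀ ε : ℝ, 0 < ε → (0 : ℝ) ≤ 1 / 2 + ε := fun ε hε => by positivity
  refine ⟨fun q _ => ⟨finite_faces_logPrime q, eulerCharacteristic_logPrime q⟩,
    fun N hN => eulerCharacteristic_logPrime_eq_mertens _ hN (ceil_exp_log_natCast_add_one N),
    ?_, ?_, ?_⟩
  -- For each fixed ε the conditions form a cycle: bound on M, real q, logarithmic form, q = ln(N +
  -- 1), bound on M. Each equivalence follows part of it in either direction.
  · refine riemannHypothesis_iff_mertens_le.trans (forall₂_congr fun ε hε =>
      ⟨fun ⟨C, hC, h⟩ => ?_, mertens_le_of_isBigO_eulerCharacteristic (h12 ε hε)⟩)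
    obtain ⟨C', hC', h'⟩ := log_eulerCharacteristic_le_of_isBigO
      (isBigO_eulerCharacteristic_of_mertens_le hC (h12 ε hε) h)
    exact isBigO_eulerCharacteristic_log_of_log_le (h12 ε hε) hC' h'
  · refine riemannHypothesis_iff_mertens_le.trans (forall₂_congr fun ε hε =>
      ⟨fun ⟨C, hC, h⟩ => isBigO_eulerCharacteristic_of_mertens_le hC (h12 ε hε) h, fun h => ?_⟩)
    obtain ⟨C, hC, h'⟩ := log_eulerCharacteristic_le_of_isBigO h
    exact mertens_le_of_isBigO_eulerCharacteristic (h12 ε hε)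
      (isBigO_eulerCharacteristic_log_of_log_le (h12 ε hε) hC h')
  · refine riemannHypothesis_iff_mertens_le.trans (forall₂_congr fun ε hε =>
      ⟨fun ⟨C, hC, h⟩ => ?_, fun ⟨C, hC, h⟩ => ?_⟩)
    · exact log_eulerCharacteristic_le_of_isBigO
        (isBigO_eulerCharacteristic_of_mertens_le hC (h12 ε hε) h)
    · exact mertens_le_of_isBigO_eulerCharacteristic (h12 ε hε)
        (isBigO_eulerCharacteristic_log_of_log_le (h12 ε hε) hC h)
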